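/- Let $K$ be a field of characteristic $0$. For $d\ge 0$ let $V_d$ be the $SL_2(K)$-module of binary forms of degree $d$, with coordinates $a_0,\dots,a_d$ given by writing a form as $\sum_{i}\binom{d}{i}a_iX^{d-i}Y^i$. Let $x_0,x_1$; $y_0,y_1$; $u_0,u_1$ be these coordinates on the three copies of $V_1$, and $v_0,v_1,v_2$ those on $V_2$, and let $\mathcal I=K[3V_1\oplus V_2]^{SL_2}$ be the algebra of polynomial $SL_2(K)$-invariant functions on $3V_1\oplus V_2$, graded by degree. Put $$\begin{aligned} L_1&=-x_0u_1v_1+x_0u_0v_2-x_1u_0v_1+x_1u_1v_0, & L_2&=-2u_0u_1v_1+u_0^2v_2+u_1^2v_0,\\ L_3&=-2v_1^2+2v_0v_2, & L_4&=-x_1^2v_0-x_0^2v_2+2x_0x_1v_1,\\ L_5&=-x_0u_1+x_1u_0, & L_6&=y_1u_1v_0-y_1u_0v_1-y_0u_1v_1+y_0u_0v_2,\\ L_7&=y_1^2v_0-2y_0y_1v_1+y_0^2v_2, & L_8&=-x_0y_1+x_1y_0,\\ L_9&=-y_0u_1+y_1u_0, & L_{10}&=x_0y_0v_2-x_0y_1v_1-x_1y_0v_1+x_1y_1v_0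 . \end{aligned}$$ (1) $L_1,\dots,L_{10}$ are homogeneous elements of $\mathcal I$ of degrees $3,3,2,3,2,3,3,2,2,3$ respectively, they generate the $K$-algebra $\mathcal I$, and no nine of them generate it. (2) Let $R=K[x_1,\dots,x_{10}]$, graded by $\deg x_i=\deg L_i$, and let $\varphi:R\to\mathcal I$ be the $K$-algebra homomorphism with $\varphi(x_i)=L_i$. The ideal $J=\ker\varphi$ is generated by the ten elements $$\begin{gathered} -x_5x_7+x_6x_8+x_9x_{10},\quad x_5x_6-x_2x_8-x_1x_9,\quad -x_1x_8+x_4x_9+x_5x_{10},\\ -x_6^2+x_2x_7-\tfrac12x_3x_9^2,\quad -x_4x_6-\tfrac12x_3x_5x_8-x_1x_{10},\quad -x_1x_6-\tfrac12x_3x_5x_9+x_2x_{10},\\ -x_1x_7-\tfrac12x_3x_8x_9+x_6x_{10},\quad -x_1^2-x_2x_4-\tfrac12x_3x_5^2,\quad -x_4x_7-\tfrac12x_3x_8^2-x_{10}^2,\\ x_2x_4x_8+\tfrac12x_3x_5^2x_8+x_1x_4x_9+x_1x_5x_{10}. \end{gathered}$$ (3) The graded $R$-module $\mathcal I$ (via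 $\varphi$) has a minimal graded free resolution of the form $$0\to R(-17)\to R(-11)^6\oplus R(-12)^3\to R(-8)^8\oplus R(-9)^8\to R(-5)^3\oplus R(-6)^6\to R\xrightarrow{\ \varphi\ }\mathcal I\to 0 ,$$ that is, the sequence is exact, its maps are homogeneous of degree $0$, and each map between free modules has image in $(x_1,\dots,x_{10})$ times its target. The projective (homological) dimension of the $R$-module $\mathcal I$ is $4$. -/

import Mathlib

open MvPolynomial
open scoped MatrixGroups

noncomputable section

namespace SL2Inv

universe u

/-! ### Binary forms and polynomial `SL₂`-invariants -/

/-- `V_d`: binary forms of degree `d`, i.e. homogeneous polynomials of degree `d` in two variables. -/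
abbrev BinaryForm (K : Type u) [Field K] (d : ℕ) : Submodule K (MvPolynomial (Fin 2) K) :=
  homogeneousSubmodule (Fin 2) K d

/-- Linear substitution of variables by `g`: `F(X, Y) ↦ F((X, Y) g)`. -/
def substitute {K : Type u} [Field K] (g : SL(2, K)) :
    MvPolynomial (Fin 2) K →ₐ[K] MvPolynomial (Fin 2) K :=
  aeval fun j => ∑ i, C (g.1 i j) * X i

lemma substitute_mem {K : Type u} [Field K] (g : SL(2, K)) {d : ℕ} {F : MvPolynomial (Fin 2) K}
    (hF : F ∈ BinaryForm K d) : substitute g F ∈ BinaryForm K d := by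
  rw [mem_homogeneousSubmodule] at hF ⊢
  have h := hF.aeval (fun j => ∑ i, C (g.1 i j) * X i : Fin 2 → MvPolynomial (Fin 2) K) (n := 1)
    (fun j => IsHomogeneous.sum _ _ _ fun i _ => (isHomogeneous_X K i).C_mul _)
  simpa [substitute] using h

lemma substitute_one {K : Type u} [Field K] (F : MvPolynomial (Fin 2) K) :
    substitute (1 : SL(2, K)) F = F := by
  have : substitute (1 : SL(2, K)) = AlgHom.id K _ := by
    apply MvPolynomial.algHom_ext
    intro j
    fin_cases j <;> simp [substitute]
  simp [this]

lemma substitute_mul {K : Type u} [Field K] (g h : SL(2, K)) (F : MvPolynomial (Fin 2) K) :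
    substitute (g * h) F = substitute g (substitute h F) := by
  have : substitute (g * h) = (substitute g).comp (substitute h) := by
    apply MvPolynomial.algHom_ext
    intro j
    simp only [substitute, AlgHom.comp_apply, aeval_X, Fin.sum_univ_two, map_add, map_mul,
      algHom_C, algebraMap_eq, Matrix.SpecialLinearGroup.coe_mul, Matrix.mul_apply]
    ring
  simp [this]

/-- The representation of `SL₂(K)` on `V_d`. -/
def binaryFormRep (K : Type u) [Field K] (d : ℕ) : Representation K SL(2, K) (BinaryForm K d) where
  toFun g := (substitute g).toLinearMap.restrict fun _ hF => substitute_mem g hF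
  map_one' := by
    ext1 F
    exact Subtype.ext (substitute_one F.1)
  map_mul' g h := by
    ext1 F
    exact Subtype.ext (substitute_mul g h F.1)

/-- The coordinates `a₀, …, a_d` on `V_d`, where a form is written as
`∑ i, (d choose i) * a_i * X ^ (d - i) * Y ^ i`. -/
def coordinate {K : Type u} [Field K] {d : ℕ} (F : BinaryForm K d) (i : Fin (d + 1)) : K :=
  ((d.choose i : ℕ) : K)⁻¹ * coeff (Finsupp.single 0 (d - i) + Finsupp.single 1 (i : ℕ)) F.1

/-- The coordinates on `V_{d₁} ⊕ ⋯ ⊕ V_{dₙ}`. -/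
def coordinates {K : Type u} [Field K] {n : ℕ} {d : Fin n → ℕ} (F : ∀ j, BinaryForm K (d j)) :
    (Σ j : Fin n, Fin (d j + 1)) → K :=
  fun c => coordinate (F c.1) c.2

/-- `K[V_{d₁} ⊕ ⋯ ⊕ V_{dₙ}]^{SL₂}`: the polynomials in the coordinates whose value at every point
of the representation is unchanged by the action of `SL₂(K)`. -/
def invariants (K : Type u) [Field K] {n : ℕ} (d : Fin n → ℕ) :
    Subalgebra K (MvPolynomial (Σ j : Fin n, Fin (d j + 1)) K) where
  carrier := {f | ∀ (g : SL(2, K)) (F : ∀ j, BinaryForm K (d j)),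
    eval (coordinates fun j => binaryFormRep K (d j) g (F j)) f = eval (coordinates F) f}
  mul_mem' ha hb g F := by simp [ha g F, hb g F]
  add_mem' ha hb g F := by simp [ha g F, hb g F]
  algebraMap_mem' r g F := by simp

/-! ### Graded free modules and minimal graded free resolutions -/

section Resolution

variable {K : Type u} [Field K] {σ : Type} (w : σ → ℕ)

/-- The degree `n` part of `R(-j)`, that is `R_{n - j}`, where `R = K[σ]` is graded by the
weights `w` of the variables. -/
def twistPiece (j n : ℕ) : Submodule K (MvPolynomial σ K) :=
  if j ≤ n then weightedHomogeneousSubmodule K w (n - j) else ⊥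

/-- The free `R`-module `R(-j₁) ⊕ ⋯ ⊕ R(-jᵣ)` for a list `s = [j₁, …, jᵣ]`. -/
abbrev FreeModule (K : Type u) [Field K] (σ : Type) (s : List ℕ) : Type u :=
  Fin s.length → MvPolynomial σ K

/-- The degree `n` part of `R(-j₁) ⊕ ⋯ ⊕ R(-jᵣ)`. -/
def freePiece (s : List ℕ) (n : ℕ) : Submodule K (FreeModule K σ s) :=
  Submodule.pi Set.univ fun a => twistPiece w (s.get a) n

/-- The ideal of `K[σ]` generated by the variables. -/
def irrelevantIdeal (K : Type u) [Field K] (σ : Type) : Ideal (MvPolynomial σ K) :=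
  Ideal.span (Set.range X)

/-- `⋯ → F₂ → F₁ → F₀ → M → 0` is a minimal graded free resolution of the graded `R`-module `M`
(with homogeneous parts `ℳ n`), where `F_i` is the graded free module with twists `s i`: the
sequence is exact, all maps are homogeneous of degree zero, and `F_{i+1}` maps into `𝔪 F_i`. -/
structure IsMinimalGradedFreeResolution {M : Type u} [AddCommGroup M]
    [Module (MvPolynomial σ K) M] (ℳ : ℕ → AddSubgroup M) (s : ℕ → List ℕ)
    (δ : ∀ i, FreeModule K σ (s (i + 1)) →ₗ[MvPolynomial σ K] FreeModule K σ (s i))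
    (ε : FreeModule K σ (s 0) →ₗ[MvPolynomial σ K] M) : Prop where
  surjective : Function.Surjective ε
  exact_zero : Function.Exact (δ 0) ε
  exact_succ : ∀ i, Function.Exact (δ (i + 1)) (δ i)
  graded_augmentation : ∀ n, ∀ v ∈ freePiece w (s 0) n, ε v ∈ ℳ n
  graded : ∀ i n, ∀ v ∈ freePiece w (s (i + 1)) n, δ i v ∈ freePiece w (s i) n
  minimal : ∀ i, LinearMap.range (δ i) ≤
    irrelevantIdeal K σ • (⊤ : Submodule (MvPolynomial σ K) (FreeModule K σ (s i)))

end Resolution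

/-! ### The algebra `K[3V₁ ⊕ V₂]^{SL₂}` -/

/-- `3V₁ ⊕ V₂`. -/
abbrev degs : Fin 4 → ℕ := ![1, 1, 1, 2]

/-- The coordinates `x₀, x₁`, `y₀, y₁`, `u₀, u₁` on the copies of `V₁` and `v₀, v₁, v₂` on `V₂`. -/
abbrev Coord : Type := Σ j : Fin 4, Fin (degs j + 1)

/-- The algebra `𝓘 = K[3V₁ ⊕ V₂]^{SL₂}`. -/
def invariantAlgebra (K : Type u) [Field K] : Subalgebra K (MvPolynomial Coord K) :=
  invariants K degs

/-- The ten listed invariants. -/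
def generator (K : Type u) [Field K] : Fin 10 → MvPolynomial Coord K :=
  let x₀ := X ⟨0, 0⟩
  let x₁ := X ⟨0, 1⟩
  let y₀ := X ⟨1, 0⟩
  let y₁ := X ⟨1, 1⟩
  let u₀ := X ⟨2, 0⟩
  let u₁ := X ⟨2, 1⟩
  let v₀ := X ⟨3, 0⟩
  let v₁ := X ⟨3, 1⟩
  let v₂ := X ⟨3, 2⟩
  ![-x₀ * u₁ * v₁ + x₀ * u₀ * v₂ - x₁ * u₀ * v₁ + x₁ * u₁ * v₀,
    -2 * u₀ * u₁ * v₁ + u₀ ^ 2 * v₂ + u₁ ^ 2 * v₀,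
    -2 * v₁ ^ 2 + 2 * v₀ * v₂,
    -x₁ ^ 2 * v₀ - x₀ ^ 2 * v₂ + 2 * x₀ * x₁ * v₁,
    -x₀ * u₁ + x₁ * u₀,
    y₁ * u₁ * v₀ - y₁ * u₀ * v₁ - y₀ * u₁ * v₁ + y₀ * u₀ * v₂,
    y₁ ^ 2 * v₀ - 2 * y₀ * y₁ * v₁ + y₀ ^ 2 * v₂,
    -x₀ * y₁ + x₁ * y₀,
    -y₀ * u₁ + y₁ * u₀,
    x₀ * y₀ * v₂ - x₀ * y₁ * v₁ - x₁ * y₀ * v₁ + x₁ * y₁ * v₀]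

/-- The degrees of the ten listed invariants, used as weights of the variables of `R`. -/
def weight : Fin 10 → ℕ := ![3, 3, 2, 3, 2, 3, 3, 2, 2, 3]

lemma eq_sum_monomial {K : Type u} [Field K] {d : ℕ} (F : BinaryForm K d) :
    F.1 = ∑ i : Fin (d + 1),
      monomial (Finsupp.single 0 (d - i) + Finsupp.single 1 (i : ℕ))
        (coeff (Finsupp.single 0 (d - i) + Finsupp.single 1 (i : ℕ)) F.1) := by
  classical
  have hF : F.1.IsHomogeneous d := (mem_homogeneousSubmodule d F.1).1 F.2
  ext m
  have hm : m = Finsupp.single 0 (m 0) + Finsupp.single 1 (m 1) := by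
    ext j; fin_cases j <;> simp
  rw [coeff_sum]
  simp only [coeff_monomial]
  by_cases h : m 0 + m 1 = d
  · rw [Finset.sum_eq_single (⟨m 1, by omega⟩ : Fin (d + 1))]
    · have h0 : d - m 1 = m 0 := by omega
      simp only [h0, ← hm, if_true]
    · intro b _ hb
      rw [if_neg]
      intro e
      apply hb
      ext
      have := DFunLike.congr_fun e 1
      simpa using this
    · simp
  · rw [Finset.sum_eq_zero, hF.coeff_eq_zero]
    · rw [hm]; simpa [Finsupp.degree_eq_sum] using h
    · intro b _
      rw [if_neg]
      intro e
      apply h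
      rw [← e]
      simp
      omega

lemma eq_linear {K : Type u} [Field K] (F : BinaryForm K 1) :
    F.1 = C (coordinate F 0) * X 0 + C (coordinate F 1) * X 1 := by
  conv_lhs => rw [eq_sum_monomial F]
  simp [Fin.sum_univ_two, coordinate, monomial_eq]

lemma eq_quadratic {K : Type u} [Field K] [CharZero K] (F : BinaryForm K 2) :
    F.1 = C (coordinate F 0) * X 0 ^ 2 + C (2 * coordinate F 1) * (X 0 * X 1)
      + C (coordinate F 2) * X 1 ^ 2 := by
  conv_lhs => rw [eq_sum_monomial F]
  simp [Fin.sum_univ_three, coordinate, monomial_eq, Finsupp.prod_add_index', pow_add]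
  rw [← Finsupp.single_tsub]

lemma coordinate_linear {K : Type u} [Field K] (F : BinaryForm K 1) (g : SL(2, K)) :
    coordinate (binaryFormRep K 1 g F) 0
        = g.1 0 0 * coordinate F 0 + g.1 0 1 * coordinate F 1 ∧
      coordinate (binaryFormRep K 1 g F) 1
        = g.1 1 0 * coordinate F 0 + g.1 1 1 * coordinate F 1 := by
  have h := eq_linear (binaryFormRep K 1 g F)
  have h2 : (binaryFormRep K 1 g F).1 = substitute g F.1 := rfl
  rw [h2, eq_linear F] at h
  have e0 := congrArg (eval ![1, 0]) h
  have e1 := congrArg (eval ![0, 1]) h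
  simp [substitute] at e0 e1
  constructor
  · rw [← e0]; ring
  · rw [← e1]; ring

lemma coordinate_quadratic {K : Type u} [Field K] [CharZero K] (F : BinaryForm K 2)
    (g : SL(2, K)) :
    coordinate (binaryFormRep K 2 g F) 0
        = g.1 0 0 ^ 2 * coordinate F 0 + 2 * g.1 0 0 * g.1 0 1 * coordinate F 1
          + g.1 0 1 ^ 2 * coordinate F 2 ∧
      coordinate (binaryFormRep K 2 g F) 1
        = g.1 0 0 * g.1 1 0 * coordinate F 0
          + (g.1 0 0 * g.1 1 1 + g.1 0 1 * g.1 1 0) * coordinate F 1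
          + g.1 0 1 * g.1 1 1 * coordinate F 2 ∧
      coordinate (binaryFormRep K 2 g F) 2
        = g.1 1 0 ^ 2 * coordinate F 0 + 2 * g.1 1 0 * g.1 1 1 * coordinate F 1
          + g.1 1 1 ^ 2 * coordinate F 2 := by
  have h := eq_quadratic (binaryFormRep K 2 g F)
  have h2 : (binaryFormRep K 2 g F).1 = substitute g F.1 := rfl
  rw [h2, eq_quadratic F] at h
  have e0 := congrArg (eval ![1, 0]) h
  have e1 := congrArg (eval ![0, 1]) h
  have e2 := congrArg (eval ![1, 1]) h
  simp [substitute] at e0 e1 e2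
  have two : (2 : K) ≠ 0 := two_ne_zero
  refine ⟨by linear_combination -e0, ?_, by linear_combination -e1⟩
  apply mul_left_cancel₀ two
  linear_combination e0 + e1 - e2

lemma generator_mem (K : Type u) [Field K] [CharZero K] (i : Fin 10) :
    generator K i ∈ invariantAlgebra K := by
  intro g F
  obtain ⟨hx0, hx1⟩ := coordinate_linear (F 0) g
  obtain ⟨hy0, hy1⟩ := coordinate_linear (F 1) g
  obtain ⟨hu0, hu1⟩ := coordinate_linear (F 2) g
  obtain ⟨hv0, hv1, hv2⟩ := coordinate_quadratic (F 3) g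
  have hdet : g.1 0 0 * g.1 1 1 - g.1 0 1 * g.1 1 0 = 1 := by
    rw [← Matrix.det_fin_two]; exact g.2
  have key : ∀ (G : ∀ j, BinaryForm K (degs j)) (x0 x1 y0 y1 u0 u1 v0 v1 v2 : K),
      coordinate (d := 1) (G 0) 0 = x0 → coordinate (d := 1) (G 0) 1 = x1 →
      coordinate (d := 1) (G 1) 0 = y0 → coordinate (d := 1) (G 1) 1 = y1 →
      coordinate (d := 1) (G 2) 0 = u0 → coordinate (d := 1) (G 2) 1 = u1 →
      coordinate (d := 2) (G 3) 0 = v0 → coordinate (d := 2) (G 3) 1 = v1 →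
      coordinate (d := 2) (G 3) 2 = v2 →
      eval (coordinates G) (generator K i) =
      ![-x0 * u1 * v1 + x0 * u0 * v2 - x1 * u0 * v1 + x1 * u1 * v0,
        -2 * u0 * u1 * v1 + u0 ^ 2 * v2 + u1 ^ 2 * v0,
        -2 * v1 ^ 2 + 2 * v0 * v2,
        -x1 ^ 2 * v0 - x0 ^ 2 * v2 + 2 * x0 * x1 * v1,
        -x0 * u1 + x1 * u0,
        y1 * u1 * v0 - y1 * u0 * v1 - y0 * u1 * v1 + y0 * u0 * v2,
        y1 ^ 2 * v0 - 2 * y0 * y1 * v1 + y0 ^ 2 * v2,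
        -x0 * y1 + x1 * y0,
        -y0 * u1 + y1 * u0,
        x0 * y0 * v2 - x0 * y1 * v1 - x1 * y0 * v1 + x1 * y1 * v0] i := by
    rintro G _ _ _ _ _ _ _ _ _ rfl rfl rfl rfl rfl rfl rfl rfl rfl
    fin_cases i <;> simp [generator] <;> rfl
  rw [key _ _ _ _ _ _ _ _ _ _ hx0 hx1 hy0 hy1 hu0 hu1 hv0 hv1 hv2,
    key F _ _ _ _ _ _ _ _ _ rfl rfl rfl rfl rfl rfl rfl rfl rfl]
  generalize g.1 0 0 = a at *
  generalize g.1 0 1 = b at *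
  generalize g.1 1 0 = c at *
  generalize g.1 1 1 = e at *
  generalize coordinate (d := 1) (F 0) 0 = x0
  generalize coordinate (d := 1) (F 0) 1 = x1
  generalize coordinate (d := 1) (F 1) 0 = y0
  generalize coordinate (d := 1) (F 1) 1 = y1
  generalize coordinate (d := 1) (F 2) 0 = u0
  generalize coordinate (d := 1) (F 2) 1 = u1
  generalize coordinate (d := 2) (F 3) 0 = v0
  generalize coordinate (d := 2) (F 3) 1 = v1
  generalize coordinate (d := 2) (F 3) 2 = v2
  clear key hx0 hx1 hy0 hy1 hu0 hu1 hv0 hv1 hv2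
  have hdet2 : (a * e - b * c) ^ 2 = 1 := by rw [hdet]; ring
  fin_cases i <;> simp
  · linear_combination (-x0 * u1 * v1 + x0 * u0 * v2 - x1 * u0 * v1 + x1 * u1 * v0) * hdet2
  · linear_combination (-2 * u0 * u1 * v1 + u0 ^ 2 * v2 + u1 ^ 2 * v0) * hdet2
  · linear_combination (-2 * v1 ^ 2 + 2 * v0 * v2) * hdet2
  · linear_combination (-x1 ^ 2 * v0 - x0 ^ 2 * v2 + 2 * x0 * x1 * v1) * hdet2
  · linear_combination (-x0 * u1 + x1 * u0) * hdet
  · linear_combination (y1 * u1 * v0 - y1 * u0 * v1 - y0 * u1 * v1 + y0 * u0 * v2) * hdet2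
  · linear_combination (y1 ^ 2 * v0 - 2 * y0 * y1 * v1 + y0 ^ 2 * v2) * hdet2
  · linear_combination (-x0 * y1 + x1 * y0) * hdet
  · linear_combination (-y0 * u1 + y1 * u0) * hdet
  · linear_combination (x0 * y0 * v2 - x0 * y1 * v1 - x1 * y0 * v1 + x1 * y1 * v0) * hdet2

/-- The polynomial ring `R = K[x₁, …, x₁₀]`; the variable `x_i` is `X (i - 1)`. -/
abbrev PolyRing (K : Type u) [Field K] : Type u := MvPolynomial (Fin 10) K

/-- The homomorphism `φ : R → 𝓘` that sends each variable to the corresponding listed invariant. -/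
def presentation (K : Type u) [Field K] [CharZero K] : PolyRing K →ₐ[K] invariantAlgebra K :=
  aeval fun i => ⟨generator K i, generator_mem K i⟩

/-- `𝓘` as an `R`-module via `φ`. -/
instance invariantModule (K : Type u) [Field K] [CharZero K] :
    Module (PolyRing K) (invariantAlgebra K) :=
  Module.compHom _ (presentation K).toRingHom

/-- The grading of `𝓘` by the degree of polynomials. -/
def invariantPiece (K : Type u) [Field K] (n : ℕ) : AddSubgroup (invariantAlgebra K) :=
  (homogeneousSubmodule Coord K n).toAddSubgroup.comap
    (invariantAlgebra K).val.toRingHom.toAddMonoidHom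

/-- The ten displayed relations. -/
def relation (K : Type u) [Field K] : Fin 10 → PolyRing K :=
  let x₁ := X 0
  let x₂ := X 1
  let x₃ := X 2
  let x₄ := X 3
  let x₅ := X 4
  let x₆ := X 5
  let x₇ := X 6
  let x₈ := X 7
  let x₉ := X 8
  let x₁₀ := X 9
  let half := C (1 / 2)
  ![-x₅ * x₇ + x₆ * x₈ + x₉ * x₁₀,
    x₅ * x₆ - x₂ * x₈ - x₁ * x₉,
    -x₁ * x₈ + x₄ * x₉ + x₅ * x₁₀,
    -x₆ ^ 2 + x₂ * x₇ - half * x₃ * x₉ ^ 2,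
    -x₄ * x₆ - half * x₃ * x₅ * x₈ - x₁ * x₁₀,
    -x₁ * x₆ - half * x₃ * x₅ * x₉ + x₂ * x₁₀,
    -x₁ * x₇ - half * x₃ * x₈ * x₉ + x₆ * x₁₀,
    -x₁ ^ 2 - x₂ * x₄ - half * x₃ * x₅ ^ 2,
    -x₄ * x₇ - half * x₃ * x₈ ^ 2 - x₁₀ ^ 2,
    x₂ * x₄ * x₈ + half * x₃ * x₅ ^ 2 * x₈ + x₁ * x₄ * x₉ + x₁ * x₅ * x₁₀]

/-- The twists of the free modules in the resolution: `F₀ = R`, `F₁ = R(-5)³ ⊕ R(-6)⁶`,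
`F₂ = R(-8)⁸ ⊕ R(-9)⁸`, `F₃ = R(-11)⁶ ⊕ R(-12)³`, `F₄ = R(-17)`, and `F_i = 0` for `i ≥ 5`. -/
def twists : ℕ → List ℕ
  | 0 => [0]
  | 1 => List.replicate 3 5 ++ List.replicate 6 6
  | 2 => List.replicate 8 8 ++ List.replicate 8 9
  | 3 => List.replicate 6 11 ++ List.replicate 3 12
  | 4 => [17]
  | _ => []

/-- The augmentation `F₀ = R → 𝓘`, which is `φ`. -/
def augmentation (K : Type u) [Field K] [CharZero K] :
    FreeModule K (Fin 10) (twists 0) →ₗ[PolyRing K] invariantAlgebra K where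
  toFun v := presentation K (v (0 : Fin 1))
  map_add' _ _ := map_add (presentation K) _ _
  map_smul' _ _ := map_mul (presentation K) _ _

end SL2Inv

end

/-! Up to sign, the generators are the entries of the Gram matrix of `x, y, u` for the quadratic
form given by `V₂`, the three brackets of these vectors, and twice the determinant of the form. Let
`J` be the ideal of the nine minimal relations; indices below start at 0, so `L₈` corresponds to `X
7`.

Both the kernel and the generation statement rest on division by the bracket `L₈` of `x` and `y`. On
points `x = s p`, `y = t p`, where `L₈ = 0`, the other generators become, up to sign, `s c, t c, s
w, t w, s² b, s t b, t² b, e, d` with `b = (p,p)`, `c = (p,u)`, `w = [p,u]`, `e = (u,u)`, `d = L₃`,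
subject to `b e = c² + d w² / 2`. Modulo `x₈`, six minimal relations are the minors of a rational
normal scroll and the other three are `s², s t, t²` times this equation. Hence `L₈ ∣ φ(F)` forces `F
∈ J + (x₈)` (`IsFibrePoint.aeval_eq_zero`, `mem_of_generator_dvd`). If `φ(F) = 0`, repeated division
puts `F` in `J + (x₈ᵏ)` for all `k`, and the grading gives `F ∈ J`. If `f` is invariant, a point
with `L₈ ≠ 0` can be moved to one whose coordinates lie in `K[L, 1/L₈]`, so `L₈ᴺ f` is a polynomial
in the `L`s; division strips off the power of `L₈`.

The resolution is an explicit self-dual complex with ranks 1, 9, 16, 9, 1. Explicit lifts of Koszul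
syzygies show that certain minimal relations annihilate its homology. Relations 3, 7, 8 are, up to
sign, monic in the variables 5, 0, 9, which do not occur in `diagonalRelation`; these four elements
form a regular sequence. Homology at `F₃`, `F₂`, `F₁` that is killed by a regular sequence of length
2, 3, 4 vanishes (`mem_range_of_smul_mem_two`, `_three`, `_four`). All entries have positive degree,
so the complex is minimal; the last map cannot split, and the projective dimension is exactly 4. -/

open MvPolynomial
open scoped MatrixGroups

noncomputable section

namespace SL2Inv

universe u

/-! ### Regular sequences of polynomials that are monic in different variables -/

section Regular

variable {K : Type u} [Field K] {n : ℕ}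

/-- Polynomials in `n + 1` variables as polynomials in the variable `i` over the polynomials in the
other variables. -/
def polynomialIn (K : Type u) [Field K] (i : Fin (n + 1)) :
    MvPolynomial (Fin (n + 1)) K ≃ₐ[K] Polynomial (MvPolynomial (Fin n) K) :=
  (renameEquiv K (finSuccEquiv' i)).trans (optionEquivLeft K (Fin n))

lemma polynomialIn_X_self (i : Fin (n + 1)) : polynomialIn K i (X i) = Polynomial.X := by
  simp [polynomialIn]

lemma polynomialIn_X_succAbove (i : Fin (n + 1)) (j : Fin n) :
    polynomialIn K i (X (i.succAbove j)) = Polynomial.C (X j) := by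
  simp [polynomialIn]

lemma exists_polynomialIn_eq_C {i : Fin (n + 1)} {g : MvPolynomial (Fin (n + 1)) K}
    (hg : g ∈ supported K ({i}ᶜ : Set (Fin (n + 1)))) :
    ∃ c, polynomialIn K i g = Polynomial.C c := by
  have : supported K ({i}ᶜ : Set (Fin (n + 1))) ≤
      ((Algebra.ofId (MvPolynomial (Fin n) K) (Polynomial (MvPolynomial (Fin n) K))).range.restrictScalars
        K).comap (polynomialIn K i).toAlgHom := by
    refine Algebra.adjoin_le ?_
    rintro _ ⟨j, hj, rfl⟩
    obtain ⟨k, rfl⟩ := Fin.exists_succAbove_eq hj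
    exact ⟨X k, (polynomialIn_X_succAbove i k).symm⟩
  obtain ⟨c, hc⟩ := this hg
  exact ⟨c, hc.symm⟩

/-- Reduced modulo `I`, the polynomial `p` stays monic, so it is a nonzerodivisor in `(S/I)[X]`. -/
lemma mem_map_C_of_monic_mul_mem {S : Type*} [CommRing S] {I : Ideal S} {p f : Polynomial S}
    (hp : p.Monic) (h : p * f ∈ I.map Polynomial.C) : f ∈ I.map Polynomial.C := by
  have key : ∀ g : Polynomial S,
      g ∈ I.map Polynomial.C ↔ g.map (Ideal.Quotient.mk I) = 0 := by
    intro g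
    simp [Ideal.mem_map_C_iff, Polynomial.ext_iff, Ideal.Quotient.eq_zero_iff_mem]
  rw [key] at h ⊢
  rw [Polynomial.map_mul] at h
  exact ((hp.map _).mul_right_eq_zero_iff).1 h

/-- A polynomial that is monic in one variable is a nonzerodivisor modulo any ideal generated by
polynomials in the other variables. -/
lemma mem_span_of_monic_mul_mem (i : Fin (n + 1)) {s : Set (MvPolynomial (Fin (n + 1)) K)}
    (hs : ∀ g ∈ s, g ∈ supported K ({i}ᶜ : Set (Fin (n + 1))))
    {c f : MvPolynomial (Fin (n + 1)) K} (hc : c ∈ supported K ({i}ᶜ : Set (Fin (n + 1))))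
    (h : (c - X i ^ 2) * f ∈ Ideal.span s) : f ∈ Ideal.span s := by
  set e := polynomialIn K i
  have hmem : ∀ g, g ∈ Ideal.span s ↔ e g ∈ (Ideal.span s).map e := fun g =>
    ⟨fun hg => Ideal.mem_map_of_mem e hg, fun hg => by
      obtain ⟨g', hg', he⟩ := (Ideal.mem_map_iff_of_surjective e e.surjective).1 hg
      rwa [← e.injective he]⟩
  obtain ⟨c', hc'⟩ := exists_polynomialIn_eq_C hc
  -- The generators do not involve the variable `i`, so the ideal is extended from the coefficient
  -- ring.
  have hmap : (Ideal.span s).map e =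
      (((Ideal.span s).map e).comap Polynomial.C).map Polynomial.C := by
    refine le_antisymm ?_ Ideal.map_comap_le
    rw [Ideal.map_le_iff_le_comap, Ideal.span_le]
    intro g hg
    obtain ⟨g', hg'⟩ := exists_polynomialIn_eq_C (hs g hg)
    change e g ∈ (((Ideal.span s).map e).comap Polynomial.C).map Polynomial.C
    rw [show e g = Polynomial.C g' from hg']
    refine Ideal.mem_map_of_mem _ ?_
    rw [Ideal.mem_comap, ← hg']
    exact Ideal.mem_map_of_mem e (Ideal.subset_span hg)
  rw [hmem] at h ⊢
  rw [hmap] at h ⊢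
  have hX : e (X i) = Polynomial.X := polynomialIn_X_self i
  have hp : (Polynomial.X ^ 2 - Polynomial.C c').Monic :=
    Polynomial.monic_X_pow_sub_C c' two_ne_zero
  refine mem_map_C_of_monic_mul_mem hp ?_
  have : (Polynomial.X ^ 2 - Polynomial.C c') * e f = -e ((c - X i ^ 2) * f) := by
    rw [map_mul, map_sub, map_pow, hX, show e c = Polynomial.C c' from hc']
    ring
  rw [this]
  exact neg_mem h

end Regular

/-! ### Acyclicity of short complexes of free modules -/

section Acyclic

variable {R : Type*} [CommRing R] {ι₁ ι₂ ι₃ ι₄ : Type*} {a₁ a₂ a₃ a₄ : R}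

lemma exists_eq_smul_of_smul_eq (h₂ : ∀ f, a₂ * f ∈ Ideal.span {a₁} → f ∈ Ideal.span {a₁})
    {u v : ι₁ → R} (h : a₂ • u = a₁ • v) : ∃ u', u = a₁ • u' := by
  have : ∀ i, ∃ c, u i = a₁ * c := fun i => by
    obtain ⟨c, hc⟩ := Ideal.mem_span_singleton.1 (h₂ (u i) (Ideal.mem_span_singleton.2
      ⟨v i, by simpa using congrFun h i⟩))
    exact ⟨c, hc⟩
  choose u' hu' using this
  exact ⟨u', funext hu'⟩

lemma exists_eq_add_of_smul_eq
    (h₃ : ∀ f, a₃ * f ∈ Ideal.span {a₁, a₂} → f ∈ Ideal.span {a₁, a₂})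
    {p α β : ι₁ → R} (h : a₃ • p = a₁ • α + a₂ • β) : ∃ s t, p = a₁ • s + a₂ • t := by
  have : ∀ i, ∃ c d, p i = a₁ * c + a₂ * d := fun i => by
    obtain ⟨c, d, hcd⟩ := Ideal.mem_span_pair.1 (h₃ (p i) (Ideal.mem_span_pair.2
      ⟨α i, β i, by simpa [mul_comm] using (congrFun h i).symm⟩))
    exact ⟨c, d, by rw [← hcd]; ring⟩
  choose s t hst using this
  exact ⟨s, t, funext hst⟩

lemma exists_eq_add_add_of_smul_eq
    (h₄ : ∀ f, a₄ * f ∈ Ideal.span {a₁, a₂, a₃} → f ∈ Ideal.span {a₁, a₂, a₃})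
    {p α β γ : ι₁ → R} (h : a₄ • p = a₁ • α + a₂ • β + a₃ • γ) :
    ∃ s t r, p = a₁ • s + a₂ • t + a₃ • r := by
  have : ∀ i, ∃ c d e, p i = a₁ * c + a₂ * d + a₃ * e := fun i => by
    obtain ⟨c, z, hz, hcz⟩ := Ideal.mem_span_insert.1 (h₄ (p i) (Ideal.mem_span_insert.2
      ⟨α i, a₂ * β i + a₃ * γ i, Ideal.mem_span_pair.2 ⟨β i, γ i, by ring⟩, by
        simpa [mul_comm, add_assoc] using congrFun h i⟩))
    obtain ⟨d, e, rfl⟩ := Ideal.mem_span_pair.1 hz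
    exact ⟨c, d, e, by rw [hcz]; ring⟩
  choose s t r hst using this
  exact ⟨s, t, r, funext hst⟩

variable [IsDomain R]

/-- If `a₁ z` and `a₂ z` lift to `y₁` and `y₂`, injectivity gives `a₂ y₁ = a₁ y₂`. Regularity then
makes `y₁` divisible by `a₁`, and the quotient lifts `z`. The two lemmas after this one run the same
Koszul argument through longer complexes. -/
lemma mem_range_of_smul_mem_two (d₁ : (ι₁ → R) →ₗ[R] (ι₂ → R)) (hd₁ : Function.Injective d₁)
    (h₁ : a₁ ≠ 0) (h₂ : ∀ f, a₂ * f ∈ Ideal.span {a₁} → f ∈ Ideal.span {a₁})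
    {z : ι₂ → R} (hz₁ : a₁ • z ∈ LinearMap.range d₁) (hz₂ : a₂ • z ∈ LinearMap.range d₁) :
    z ∈ LinearMap.range d₁ := by
  obtain ⟨y₁, hy₁⟩ := hz₁
  obtain ⟨y₂, hy₂⟩ := hz₂
  obtain ⟨y, rfl⟩ := exists_eq_smul_of_smul_eq h₂ (u := y₁) (v := y₂) (hd₁ (by
    rw [map_smul, map_smul, hy₁, hy₂, smul_comm]))
  exact ⟨y, smul_right_injective _ h₁ (by simpa using hy₁)⟩

lemma mem_range_of_smul_mem_three (d₁ : (ι₁ → R) →ₗ[R] (ι₂ → R)) (d₂ : (ι₂ → R) →ₗ[R] (ι₃ → R))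
    (hd₁ : Function.Injective d₁) (hd₂ : Function.Exact d₁ d₂)
    (h₁ : a₁ ≠ 0) (h₂ : ∀ f, a₂ * f ∈ Ideal.span {a₁} → f ∈ Ideal.span {a₁})
    (h₃ : ∀ f, a₃ * f ∈ Ideal.span {a₁, a₂} → f ∈ Ideal.span {a₁, a₂})
    {z : ι₃ → R} (hz₁ : a₁ • z ∈ LinearMap.range d₂) (hz₂ : a₂ • z ∈ LinearMap.range d₂)
    (hz₃ : a₃ • z ∈ LinearMap.range d₂) : z ∈ LinearMap.range d₂ := by
  obtain ⟨y₁, hy₁⟩ := hz₁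
  obtain ⟨y₂, hy₂⟩ := hz₂
  obtain ⟨y₃, hy₃⟩ := hz₃
  obtain ⟨p, hp⟩ := (hd₂ (a₁ • y₂ - a₂ • y₁)).1 (by
    rw [map_sub, map_smul, map_smul, hy₁, hy₂, smul_comm, sub_self])
  obtain ⟨p', hp'⟩ := (hd₂ (a₁ • y₃ - a₃ • y₁)).1 (by
    rw [map_sub, map_smul, map_smul, hy₁, hy₃, smul_comm, sub_self])
  obtain ⟨p'', hp''⟩ := (hd₂ (a₂ • y₃ - a₃ • y₂)).1 (by
    rw [map_sub, map_smul, map_smul, hy₂, hy₃, smul_comm, sub_self])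
  -- The alternating sum of the three `p`s lies in the kernel of the injective `d₁`. Decomposing `p`
  -- shows how to correct `y₁` and `y₂` so that they become compatible.
  obtain ⟨s, t, rfl⟩ := exists_eq_add_of_smul_eq h₃ (p := p) (α := -p'') (β := p') (hd₁ (by
    simp only [map_add, map_smul, map_neg, hp, hp', hp'']
    module))
  obtain ⟨y, hy⟩ := exists_eq_smul_of_smul_eq h₂ (u := y₁ + d₁ t) (v := y₂ - d₁ s) (by
    simp only [map_add, map_smul] at hp
    linear_combination (norm := module) hp)
  refine ⟨y, smul_right_injective _ h₁ ?_⟩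
  have : d₂ (y₁ + d₁ t) = a₁ • z := by rw [map_add, hy₁, hd₂.apply_apply_eq_zero, add_zero]
  change a₁ • d₂ y = a₁ • z
  rw [← this, hy, map_smul]

lemma mem_range_of_smul_mem_four (d₁ : (ι₁ → R) →ₗ[R] (ι₂ → R)) (d₂ : (ι₂ → R) →ₗ[R] (ι₃ → R))
    (d₃ : (ι₃ → R) →ₗ[R] (ι₄ → R)) (hd₁ : Function.Injective d₁) (hd₂ : Function.Exact d₁ d₂)
    (hd₃ : Function.Exact d₂ d₃)
    (h₁ : a₁ ≠ 0) (h₂ : ∀ f, a₂ * f ∈ Ideal.span {a₁} → f ∈ Ideal.span {a₁})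
    (h₃ : ∀ f, a₃ * f ∈ Ideal.span {a₁, a₂} → f ∈ Ideal.span {a₁, a₂})
    (h₄ : ∀ f, a₄ * f ∈ Ideal.span {a₁, a₂, a₃} → f ∈ Ideal.span {a₁, a₂, a₃})
    {z : ι₄ → R} (hz₁ : a₁ • z ∈ LinearMap.range d₃) (hz₂ : a₂ • z ∈ LinearMap.range d₃)
    (hz₃ : a₃ • z ∈ LinearMap.range d₃) (hz₄ : a₄ • z ∈ LinearMap.range d₃) :
    z ∈ LinearMap.range d₃ := by
  -- `pair` and `triple` lift the failure of the chosen lifts to form a Koszul cocycle, one step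
  -- further left each time.
  have pair : ∀ {a b : R} {y y' : ι₃ → R}, d₃ y = a • z → d₃ y' = b • z →
      ∃ p, d₂ p = a • y' - b • y := fun {a b y y'} hy hy' => (hd₃ _).1 (by
    rw [map_sub, map_smul, map_smul, hy, hy', smul_comm, sub_self])
  have triple : ∀ {a b c : R} {y y' y'' : ι₃ → R} {p p' p'' : ι₂ → R}, d₂ p = a • y' - b • y →
      d₂ p' = a • y'' - c • y → d₂ p'' = b • y'' - c • y' →
      ∃ q, d₁ q = a • p'' - b • p' + c • p := fun {a b c y y' y'' p p' p''} hp hp' hp'' =>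
    (hd₂ _).1 (by
      simp only [map_add, map_sub, map_smul, hp, hp', hp'']
      module)
  obtain ⟨y₁, hy₁⟩ := hz₁
  obtain ⟨y₂, hy₂⟩ := hz₂
  obtain ⟨y₃, hy₃⟩ := hz₃
  obtain ⟨y₄, hy₄⟩ := hz₄
  obtain ⟨p₁₂, h₁₂⟩ := pair hy₁ hy₂
  obtain ⟨p₁₃, h₁₃⟩ := pair hy₁ hy₃
  obtain ⟨p₁₄, h₁₄⟩ := pair hy₁ hy₄
  obtain ⟨p₂₃, h₂₃⟩ := pair hy₂ hy₃
  obtain ⟨p₂₄, h₂₄⟩ := pair hy₂ hy₄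
  obtain ⟨p₃₄, h₃₄⟩ := pair hy₃ hy₄
  obtain ⟨q₁₂₃, h₁₂₃⟩ := triple h₁₂ h₁₃ h₂₃
  obtain ⟨q₁₂₄, h₁₂₄⟩ := triple h₁₂ h₁₄ h₂₄
  obtain ⟨q₁₃₄, h₁₃₄⟩ := triple h₁₃ h₁₄ h₃₄
  obtain ⟨q₂₃₄, h₂₃₄⟩ := triple h₂₃ h₂₄ h₃₄
  -- At the injective end the cocycle condition holds exactly. The decomposition is pushed back to
  -- the right: the `q`s correct the `p`s, and these correct the `y`s.
  obtain ⟨α, β, γ, rfl⟩ := exists_eq_add_add_of_smul_eq h₄ (p := q₁₂₃) (α := q₂₃₄) (β := -q₁₃₄)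
    (γ := q₁₂₄) (hd₁ (by
      simp only [map_add, map_smul, map_neg, h₁₂₃, h₁₂₄, h₁₃₄, h₂₃₄]
      module))
  obtain ⟨s, t, hst⟩ := exists_eq_add_of_smul_eq h₃ (p := p₁₂ - d₁ γ) (α := d₁ α - p₂₃)
    (β := p₁₃ + d₁ β) (by
      simp only [map_add, map_smul] at h₁₂₃
      linear_combination (norm := module) -h₁₂₃)
  obtain ⟨y, hy⟩ := exists_eq_smul_of_smul_eq h₂ (u := y₁ + d₂ t) (v := y₂ - d₂ s) (by
    have := congrArg d₂ hst
    simp only [map_add, map_sub, map_smul, hd₂.apply_apply_eq_zero, sub_zero, h₁₂] at this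
    linear_combination (norm := module) -this)
  refine ⟨y, smul_right_injective _ h₁ ?_⟩
  have : d₃ (y₁ + d₂ t) = a₁ • z := by rw [map_add, hy₁, hd₃.apply_apply_eq_zero, add_zero]
  change a₁ • d₃ y = a₁ • z
  rw [← this, hy, map_smul]

end Acyclic

/-! ### The complex attached to ten elements of a commutative ring

The elements `x 0, …, x 9` stand for the variables, except that `x 2` stands for half the third one. -/

section Complex

open scoped Matrix

/-! ### The explicit matrices, and the lifts of Koszul syzygies. -/

section Complex

variable {R : Type*} [CommRing R] (x : Fin 10 → R)

/-- The nine minimal relations. -/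
def minimalRelation : Fin 9 → R :=
  ![-x 4 * x 6 + x 5 * x 7 + x 8 * x 9, -x 0 * x 8 - x 1 * x 7 + x 4 * x 5,
    -x 0 * x 7 + x 3 * x 8 + x 4 * x 9, x 1 * x 6 - x 2 * x 8 ^ 2 - x 5 ^ 2,
    -x 0 * x 9 - x 2 * x 4 * x 7 - x 3 * x 5, -x 0 * x 5 + x 1 * x 9 - x 2 * x 4 * x 8,
    -x 0 * x 6 - x 2 * x 7 * x 8 + x 5 * x 9, -x 0 ^ 2 - x 1 * x 3 - x 2 * x 4 ^ 2,
    -x 2 * x 7 ^ 2 - x 3 * x 6 - x 9 ^ 2]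

/-- The first syzygies of the nine minimal relations. -/
def syzygyMatrix : Matrix (Fin 9) (Fin 16) R :=
  !![-x 5, -x 1, 0, 0, -x 3, x 9, -x 0, 0, 0, 0, x 2 * x 8, x 2 * x 7, 0, 0, 0, -x 2 * x 4;
     -x 6, -x 5, -x 3, x 0, 0, 0, -x 9, x 9, 0, 0, 0, 0, -x 2 * x 8, x 2 * x 4, x 2 * x 7,
     x 2 * x 7;
     0, 0, -x 0, -x 1, x 9, x 6, 0, -x 5, x 2 * x 4, -x 2 * x 7, 0, 0, 0, 0, -x 2 * x 8, 0;
     -x 7, -x 4, 0, 0, 0, 0, 0, 0, 0, 0, x 9, 0, x 0, 0, -x 3, 0;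
     0, 0, -x 4, 0, -x 7, 0, 0, -x 8, -x 0, -x 9, 0, -x 6, 0, -x 1, x 5, 0;
     0, x 8, 0, x 4, 0, 0, -x 7, x 7, x 3, 0, -x 6, 0, -x 5, -x 0, -x 9, -x 9;
     x 8, 0, 0, 0, 0, -x 7, x 4, 0, 0, -x 3, x 5, x 9, x 1, 0, 0, -x 0;
     0, 0, x 7, -x 8, 0, 0, 0, 0, x 9, 0, 0, 0, 0, x 5, 0, x 6;
     0, 0, 0, 0, x 4, x 8, 0, 0, 0, x 0, 0, x 5, 0, 0, -x 1, -x 1]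

lemma syzygyMatrix_mulVec (z : Fin 16 → R) : syzygyMatrix x *ᵥ z =
    ![-x 5 * z 0 - x 1 * z 1 - x 3 * z 4 + x 9 * z 5 - x 0 * z 6 + x 2 * x 8 * z 10
        + x 2 * x 7 * z 11 - x 2 * x 4 * z 15,
      -x 6 * z 0 - x 5 * z 1 - x 3 * z 2 + x 0 * z 3 - x 9 * z 6 + x 9 * z 7
        - x 2 * x 8 * z 12 + x 2 * x 4 * z 13 + x 2 * x 7 * z 14 + x 2 * x 7 * z 15,
      -x 0 * z 2 - x 1 * z 3 + x 9 * z 4 + x 6 * z 5 - x 5 * z 7 + x 2 * x 4 * z 8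
        - x 2 * x 7 * z 9 - x 2 * x 8 * z 14,
      -x 7 * z 0 - x 4 * z 1 + x 9 * z 10 + x 0 * z 12 - x 3 * z 14,
      -x 4 * z 2 - x 7 * z 4 - x 8 * z 7 - x 0 * z 8 - x 9 * z 9 - x 6 * z 11 - x 1 * z 13
        + x 5 * z 14,
      x 8 * z 1 + x 4 * z 3 - x 7 * z 6 + x 7 * z 7 + x 3 * z 8 - x 6 * z 10 - x 5 * z 12
        - x 0 * z 13 - x 9 * z 14 - x 9 * z 15,
      x 8 * z 0 - x 7 * z 5 + x 4 * z 6 - x 3 * z 9 + x 5 * z 10 + x 9 * z 11 + x 1 * z 12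
        - x 0 * z 15,
      x 7 * z 2 - x 8 * z 3 + x 9 * z 8 + x 5 * z 13 + x 6 * z 15,
      x 4 * z 4 + x 8 * z 5 + x 0 * z 9 + x 5 * z 11 - x 1 * z 14 - x 1 * z 15] := by
  ext i
  fin_cases i <;>
    simp [syzygyMatrix, Matrix.mulVec, dotProduct, Fin.sum_univ_succ] <;> ring

lemma vecMul_syzygyMatrix (z : Fin 9 → R) : z ᵥ* syzygyMatrix x =
    ![-x 5 * z 0 - x 6 * z 1 - x 7 * z 3 + x 8 * z 6,
      -x 1 * z 0 - x 5 * z 1 - x 4 * z 3 + x 8 * z 5,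
      -x 3 * z 1 - x 0 * z 2 - x 4 * z 4 + x 7 * z 7,
      x 0 * z 1 - x 1 * z 2 + x 4 * z 5 - x 8 * z 7,
      -x 3 * z 0 + x 9 * z 2 - x 7 * z 4 + x 4 * z 8,
      x 9 * z 0 + x 6 * z 2 - x 7 * z 6 + x 8 * z 8,
      -x 0 * z 0 - x 9 * z 1 - x 7 * z 5 + x 4 * z 6,
      x 9 * z 1 - x 5 * z 2 - x 8 * z 4 + x 7 * z 5,
      x 2 * x 4 * z 2 - x 0 * z 4 + x 3 * z 5 + x 9 * z 7,
      -x 2 * x 7 * z 2 - x 9 * z 4 - x 3 * z 6 + x 0 * z 8,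
      x 2 * x 8 * z 0 + x 9 * z 3 - x 6 * z 5 + x 5 * z 6,
      x 2 * x 7 * z 0 - x 6 * z 4 + x 9 * z 6 + x 5 * z 8,
      -x 2 * x 8 * z 1 + x 0 * z 3 - x 5 * z 5 + x 1 * z 6,
      x 2 * x 4 * z 1 - x 1 * z 4 - x 0 * z 5 + x 5 * z 7,
      x 2 * x 7 * z 1 - x 2 * x 8 * z 2 - x 3 * z 3 + x 5 * z 4 - x 9 * z 5 - x 1 * z 8,
      -x 2 * x 4 * z 0 + x 2 * x 7 * z 1 - x 9 * z 5 - x 0 * z 6 + x 6 * z 7 - x 1 * z 8] := by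
  ext i
  fin_cases i <;>
    simp [syzygyMatrix, Matrix.vecMul, dotProduct, Fin.sum_univ_succ] <;> ring

/-- Write `m` for `minimalRelation x`. The coefficient of `z j` in the witness is a vector that
`syzygyMatrix` sends to the Koszul syzygy `m₀ eⱼ - mⱼ e₀`. Summing over `j` gives `m₀ z - (m ⬝ᵥ z)
e₀`, so the hypothesis is used only in row 0. The analogues for the relations 1, 2, 3, 7, 8 have the
same structure. -/
lemma exists_syzygyMatrix_mulVec_eq_smul_0 {z : Fin 9 → R}
    (hz : minimalRelation x ⬝ᵥ z = 0) :
    ∃ y, syzygyMatrix x *ᵥ y = minimalRelation x 0 • z := by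
  simp [minimalRelation, dotProduct, Fin.sum_univ_succ] at hz
  refine ⟨![x 4 * z 1 - x 5 * z 3 + x 9 * z 6, -x 7 * z 1 + x 6 * z 3 + x 9 * z 5, 0, -x 9 * z 7,
    x 8 * z 2 - x 5 * z 4 - x 1 * z 7 - x 6 * z 8, -x 4 * z 2 + x 9 * z 8,
    -x 8 * z 1 - x 7 * z 2 - x 9 * z 4 - x 5 * z 5 - x 6 * z 6 - x 0 * z 7,
    -x 7 * z 2 - x 9 * z 4, 0, 0, x 8 * z 3 + x 4 * z 5 + x 7 * z 6, x 4 * z 4 + x 7 * z 8, 0,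
    x 7 * z 7, 0, -x 4 * z 7], ?_⟩
  rw [syzygyMatrix_mulVec]
  ext i
  fin_cases i <;> simp [minimalRelation]
  · linear_combination -hz
  · ring
  · ring
  · ring
  · ring
  · ring
  · ring
  · ring
  · ring

lemma exists_syzygyMatrix_mulVec_eq_smul_1 {z : Fin 9 → R}
    (hz : minimalRelation x ⬝ᵥ z = 0) :
    ∃ y, syzygyMatrix x *ᵥ y = minimalRelation x 1 • z := by
  simp [minimalRelation, dotProduct, Fin.sum_univ_succ] at hz
  refine ⟨![-x 4 * z 0 + x 1 * z 3 - x 0 * z 6 - x 3 * z 8, x 7 * z 0 - x 5 * z 3,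
    x 8 * z 2 - x 5 * z 4 - x 1 * z 7, x 7 * z 2 + x 5 * z 5 + x 0 * z 7, x 5 * z 8, 0,
    x 8 * z 0 + x 5 * z 6, -x 4 * z 2 + x 0 * z 4 - x 1 * z 5 + x 9 * z 8, 0, -x 8 * z 8, 0, 0,
    -x 8 * z 3 - x 7 * z 6, x 7 * z 4 + x 8 * z 5 + x 4 * z 7, x 7 * z 8, 0], ?_⟩
  rw [syzygyMatrix_mulVec]
  ext i
  fin_cases i <;> simp [minimalRelation]
  · ring
  · linear_combination -hz
  · ring
  · ring
  · ring
  · ring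
  · ring
  · ring
  · ring

lemma exists_syzygyMatrix_mulVec_eq_smul_2 {z : Fin 9 → R}
    (hz : minimalRelation x ⬝ᵥ z = 0) :
    ∃ y, syzygyMatrix x *ᵥ y = minimalRelation x 2 • z := by
  simp [minimalRelation, dotProduct, Fin.sum_univ_succ] at hz
  refine ⟨![0, -x 9 * z 3, -x 8 * z 1 - x 9 * z 4 - x 0 * z 7, -x 7 * z 1 + x 9 * z 5 - x 3 * z 7,
    -x 8 * z 0 + x 9 * z 8, x 4 * z 0 - x 1 * z 3 + x 0 * z 6 + x 3 * z 8, x 7 * z 0 + x 9 * z 6,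
    x 7 * z 0 + x 4 * z 1 - x 5 * z 3 - x 3 * z 4 - x 0 * z 5 + x 9 * z 6,
    x 7 * z 4 + x 8 * z 5 + x 4 * z 7, -x 8 * z 6 - x 7 * z 8, 0, 0, -x 7 * z 3, 0, -x 8 * z 3, 0], ?_⟩
  rw [syzygyMatrix_mulVec]
  ext i
  fin_cases i <;> simp [minimalRelation]
  · ring
  · ring
  · linear_combination -hz
  · ring
  · ring
  · ring
  · ring
  · ring
  · ring

lemma exists_syzygyMatrix_mulVec_eq_smul_3 {z : Fin 9 → R}
    (hz : minimalRelation x ⬝ᵥ z = 0) :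
    ∃ y, syzygyMatrix x *ᵥ y = minimalRelation x 3 • z := by
  simp [minimalRelation, dotProduct, Fin.sum_univ_succ] at hz
  refine ⟨![x 5 * z 0 - x 1 * z 1 - x 2 * x 8 * z 6 - x 2 * x 7 * z 8,
    -x 6 * z 0 + x 5 * z 1 + x 9 * z 2 - x 2 * x 7 * z 4 - x 2 * x 8 * z 5 - x 2 * x 4 * z 7, 0,
    x 2 * x 8 * z 7, 0, x 1 * z 2 - x 2 * x 8 * z 8, 0, x 5 * z 2 + x 2 * x 8 * z 4, 0, 0,
    -x 8 * z 0 - x 1 * z 5 - x 5 * z 6 + x 9 * z 8, -x 1 * z 4 - x 5 * z 8,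
    x 8 * z 1 + x 7 * z 2 + x 9 * z 4 + x 5 * z 5 + x 6 * z 6 + x 0 * z 7, -x 5 * z 7,
    x 8 * z 2 - x 5 * z 4 - x 1 * z 7 - x 6 * z 8, x 1 * z 7], ?_⟩
  rw [syzygyMatrix_mulVec]
  ext i
  fin_cases i <;> simp [minimalRelation]
  · ring
  · ring
  · ring
  · linear_combination -hz
  · ring
  · ring
  · ring
  · ring
  · ring

lemma exists_syzygyMatrix_mulVec_eq_smul_7 {z : Fin 9 → R}
    (hz : minimalRelation x ⬝ᵥ z = 0) :
    ∃ y, syzygyMatrix x *ᵥ y = minimalRelation x 7 • z := by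
  simp [minimalRelation, dotProduct, Fin.sum_univ_succ] at hz
  refine ⟨![0, x 2 * x 4 * z 3, x 1 * z 1 + x 0 * z 2 + x 2 * x 4 * z 4 + x 2 * x 7 * z 8,
    x 9 * z 0 - x 0 * z 1 + x 3 * z 2 - x 2 * x 8 * z 3 - x 2 * x 4 * z 5 - x 2 * x 7 * z 6,
    x 1 * z 0 - x 2 * x 4 * z 8, 0, x 0 * z 0 - x 2 * x 4 * z 6, 0,
    -x 4 * z 2 + x 0 * z 4 - x 1 * z 5 + x 9 * z 8, x 1 * z 6 - x 0 * z 8, 0, 0, -x 0 * z 3,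
    -x 7 * z 0 - x 4 * z 1 + x 5 * z 3 + x 3 * z 4 + x 0 * z 5 - x 9 * z 6, x 1 * z 3,
    x 4 * z 0 - x 1 * z 3 + x 0 * z 6 + x 3 * z 8], ?_⟩
  rw [syzygyMatrix_mulVec]
  ext i
  fin_cases i <;> simp [minimalRelation]
  · ring
  · ring
  · ring
  · ring
  · ring
  · ring
  · ring
  · linear_combination -hz
  · ring

lemma exists_syzygyMatrix_mulVec_eq_smul_8 {z : Fin 9 → R}
    (hz : minimalRelation x ⬝ᵥ z = 0) :
    ∃ y, syzygyMatrix x *ᵥ y = minimalRelation x 8 • z := by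
  simp [minimalRelation, dotProduct, Fin.sum_univ_succ] at hz
  refine ⟨![x 3 * z 1 + x 2 * x 7 * z 3, 0, -x 2 * x 7 * z 7, 0,
    x 6 * z 0 - x 5 * z 1 - x 9 * z 2 + x 2 * x 7 * z 4 + x 2 * x 8 * z 5 + x 2 * x 4 * z 7,
    -x 9 * z 0 - x 3 * z 2 + x 2 * x 8 * z 3 + x 2 * x 7 * z 6, 0, -x 9 * z 1 - x 2 * x 7 * z 5,
    -x 9 * z 7, x 8 * z 1 + x 7 * z 2 + x 9 * z 4 + x 5 * z 5 + x 6 * z 6 + x 0 * z 7,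
    -x 9 * z 3 + x 3 * z 5, -x 7 * z 0 + x 5 * z 3 + x 3 * z 4 - x 9 * z 6, 0, 0,
    -x 7 * z 1 + x 6 * z 3 + x 9 * z 5, -x 3 * z 7], ?_⟩
  rw [syzygyMatrix_mulVec]
  ext i
  fin_cases i <;> simp [minimalRelation]
  · ring
  · ring
  · ring
  · ring
  · ring
  · ring
  · ring
  · ring
  · linear_combination -hz

/-- The transpose of the homotopy in `exists_syzygyMatrix_mulVec_eq_smul_3`: pairing `z` with the
Koszul syzygy `m₃ eⱼ - mⱼ e₃`, which lies in the image of `syzygyMatrix`, gives zero. -/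
lemma minimalRelation_smul_eq_3 {z : Fin 9 → R} (hz : z ᵥ* syzygyMatrix x = 0) :
    minimalRelation x 3 • z = z 3 • minimalRelation x := by
  have h : ∀ k, (z ᵥ* syzygyMatrix x) k = 0 := fun k => by rw [hz]; rfl
  rw [vecMul_syzygyMatrix] at h
  simp [Fin.forall_fin_succ] at h
  obtain ⟨h0, h1, h2, h3, h4, h5, h6, h7, h8, h9, h10, h11, h12, h13, h14, h15⟩ := h
  ext i
  fin_cases i <;> simp [minimalRelation]
  · linear_combination x 5 * h0 - x 6 * h1 - x 8 * h10
  · linear_combination -x 1 * h0 + x 5 * h1 + x 8 * h12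
  · linear_combination x 9 * h1 + x 1 * h5 + x 5 * h7 + x 7 * h12 + x 8 * h14
  · ring
  · linear_combination -x 2 * x 7 * h1 + x 2 * x 8 * h7 - x 1 * h11 + x 9 * h12 - x 5 * h14
  · linear_combination -x 2 * x 8 * h1 - x 1 * h10 + x 5 * h12
  · linear_combination -x 2 * x 8 * h0 - x 5 * h10 + x 6 * h12
  · linear_combination -x 2 * x 4 * h1 + x 2 * x 8 * h3 + x 0 * h12 - x 5 * h13 - x 1 * h14 + x 1 * h15
  · linear_combination -x 2 * x 7 * h0 - x 2 * x 8 * h5 + x 9 * h10 - x 5 * h11 - x 6 * h14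

lemma minimalRelation_smul_eq_7 {z : Fin 9 → R} (hz : z ᵥ* syzygyMatrix x = 0) :
    minimalRelation x 7 • z = z 7 • minimalRelation x := by
  have h : ∀ k, (z ᵥ* syzygyMatrix x) k = 0 := fun k => by rw [hz]; rfl
  rw [vecMul_syzygyMatrix] at h
  simp [Fin.forall_fin_succ] at h
  obtain ⟨h0, h1, h2, h3, h4, h5, h6, h7, h8, h9, h10, h11, h12, h13, h14, h15⟩ := h
  ext i
  fin_cases i <;> simp [minimalRelation]
  · linear_combination x 9 * h3 + x 1 * h4 + x 0 * h6 - x 7 * h13 + x 4 * h15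
  · linear_combination x 1 * h2 - x 0 * h3 - x 4 * h13
  · linear_combination x 0 * h2 + x 3 * h3 - x 4 * h8
  · linear_combination x 2 * x 4 * h1 - x 2 * x 8 * h3 - x 0 * h12 + x 5 * h13 + x 1 * h14 - x 1 * h15
  · linear_combination x 2 * x 4 * h2 + x 0 * h8 + x 3 * h13
  · linear_combination -x 2 * x 4 * h3 - x 1 * h8 + x 0 * h13
  · linear_combination -x 2 * x 7 * h3 - x 2 * x 4 * h6 + x 1 * h9 - x 9 * h13 + x 0 * h15
  · ring
  · linear_combination x 2 * x 7 * h2 - x 2 * x 4 * h4 + x 9 * h8 - x 0 * h9 + x 3 * h15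

/-- The next stage of the same null-homotopy: `m₃ z` is the image of `y` under the third
differential plus the lift of Koszul syzygies applied to `syzygyMatrix x *ᵥ z`, which is zero. By
self-duality `y` comes from the transposed lift, with indices shifted by 8. -/
lemma exists_vecMul_syzygyMatrix_eq_3 {z : Fin 16 → R} (hz : syzygyMatrix x *ᵥ z = 0) :
    ∃ y, ∀ k, (y ᵥ* syzygyMatrix x) (k + 8) = minimalRelation x 3 * z k := by
  have h : ∀ k, (syzygyMatrix x *ᵥ z) k = 0 := fun k => by rw [hz]; rfl
  rw [syzygyMatrix_mulVec] at h
  simp [Fin.forall_fin_succ] at h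
  obtain ⟨h0, h1, h2, h3, h4, h5, h6, h7, h8⟩ := h
  refine ⟨![x 5 * z 8 - x 6 * z 9 - x 8 * z 2, -x 1 * z 8 + x 5 * z 9 + x 8 * z 4,
    x 9 * z 9 + x 1 * z 13 + x 5 * z 15 + x 7 * z 4 + x 8 * z 6, 0,
    -x 2 * x 7 * z 9 + x 2 * x 8 * z 15 - x 1 * z 3 + x 9 * z 4 - x 5 * z 6,
    -x 2 * x 8 * z 9 - x 1 * z 2 + x 5 * z 4, -x 2 * x 8 * z 8 - x 5 * z 2 + x 6 * z 4,
    -x 2 * x 4 * z 9 + x 2 * x 8 * z 11 + x 0 * z 4 - x 5 * z 5 - x 1 * z 6 + x 1 * z 7,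
    -x 2 * x 7 * z 8 - x 2 * x 8 * z 13 + x 9 * z 2 - x 5 * z 3 - x 6 * z 6], fun k => ?_⟩
  rw [vecMul_syzygyMatrix]
  fin_cases k <;> simp [minimalRelation]
  · linear_combination -x 5 * h0 + x 1 * h1 + x 2 * x 8 * h6 + x 2 * x 7 * h8
  · linear_combination x 6 * h0 - x 5 * h1 - x 9 * h2 + x 2 * x 7 * h4 + x 2 * x 8 * h5 + x 2 * x 4 * h7
  · ring
  · linear_combination -x 2 * x 8 * h7
  · ring
  · linear_combination -x 1 * h2 + x 2 * x 8 * h8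
  · ring
  · linear_combination -x 5 * h2 - x 2 * x 8 * h4
  · ring
  · ring
  · linear_combination x 8 * h0 + x 1 * h5 + x 5 * h6 - x 9 * h8
  · linear_combination x 1 * h4 + x 5 * h8
  · linear_combination -x 8 * h1 - x 7 * h2 - x 9 * h4 - x 5 * h5 - x 6 * h6 - x 0 * h7
  · linear_combination x 5 * h7
  · linear_combination -x 8 * h2 + x 5 * h4 + x 1 * h7 + x 6 * h8
  · linear_combination -x 1 * h7

lemma exists_vecMul_syzygyMatrix_eq_7 {z : Fin 16 → R} (hz : syzygyMatrix x *ᵥ z = 0) :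
    ∃ y, ∀ k, (y ᵥ* syzygyMatrix x) (k + 8) = minimalRelation x 7 * z k := by
  have h : ∀ k, (syzygyMatrix x *ᵥ z) k = 0 := fun k => by rw [hz]; rfl
  rw [syzygyMatrix_mulVec] at h
  simp [Fin.forall_fin_succ] at h
  obtain ⟨h0, h1, h2, h3, h4, h5, h6, h7, h8⟩ := h
  refine ⟨![x 9 * z 11 + x 1 * z 12 + x 0 * z 14 - x 7 * z 5 + x 4 * z 7,
    x 1 * z 10 - x 0 * z 11 - x 4 * z 5, x 0 * z 10 + x 3 * z 11 - x 4 * z 0,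
    x 2 * x 4 * z 9 - x 2 * x 8 * z 11 - x 0 * z 4 + x 5 * z 5 + x 1 * z 6 - x 1 * z 7,
    x 2 * x 4 * z 10 + x 0 * z 0 + x 3 * z 5, -x 2 * x 4 * z 11 - x 1 * z 0 + x 0 * z 5,
    -x 2 * x 7 * z 11 - x 2 * x 4 * z 14 + x 1 * z 1 - x 9 * z 5 + x 0 * z 7, 0,
    x 2 * x 7 * z 10 - x 2 * x 4 * z 12 + x 9 * z 0 - x 0 * z 1 + x 3 * z 7], fun k => ?_⟩
  rw [vecMul_syzygyMatrix]
  fin_cases k <;> simp [minimalRelation]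
  · ring
  · linear_combination -x 2 * x 4 * h3
  · linear_combination -x 1 * h1 - x 0 * h2 - x 2 * x 4 * h4 - x 2 * x 7 * h8
  · linear_combination -x 9 * h0 + x 0 * h1 - x 3 * h2 + x 2 * x 8 * h3 + x 2 * x 4 * h5 + x 2 * x 7 * h6
  · linear_combination -x 1 * h0 + x 2 * x 4 * h8
  · ring
  · linear_combination -x 0 * h0 + x 2 * x 4 * h6
  · ring
  · linear_combination x 4 * h2 - x 0 * h4 + x 1 * h5 - x 9 * h8
  · linear_combination -x 1 * h6 + x 0 * h8
  · ring
  · ring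
  · linear_combination x 0 * h3
  · linear_combination x 7 * h0 + x 4 * h1 - x 5 * h3 - x 3 * h4 - x 0 * h5 + x 9 * h6
  · linear_combination -x 1 * h3
  · linear_combination -x 4 * h0 + x 1 * h3 - x 0 * h6 - x 3 * h8

lemma exists_vecMul_syzygyMatrix_eq_8 {z : Fin 16 → R} (hz : syzygyMatrix x *ᵥ z = 0) :
    ∃ y, ∀ k, (y ᵥ* syzygyMatrix x) (k + 8) = minimalRelation x 8 * z k := by
  have h : ∀ k, (syzygyMatrix x *ᵥ z) k = 0 := fun k => by rw [hz]; rfl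
  rw [syzygyMatrix_mulVec] at h
  simp [Fin.forall_fin_succ] at h
  obtain ⟨h0, h1, h2, h3, h4, h5, h6, h7, h8⟩ := h
  refine ⟨![x 6 * z 12 - x 9 * z 13 - x 7 * z 3,
    x 3 * z 8 - x 5 * z 12 - x 9 * z 15 + x 8 * z 1 - x 7 * z 6,
    -x 9 * z 12 - x 3 * z 13 + x 7 * z 1,
    x 2 * x 7 * z 8 + x 2 * x 8 * z 13 - x 9 * z 2 + x 5 * z 3 + x 6 * z 6,
    x 2 * x 7 * z 12 + x 9 * z 1 + x 3 * z 3,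
    x 2 * x 8 * z 12 - x 2 * x 7 * z 15 + x 5 * z 1 + x 3 * z 2 + x 9 * z 6,
    x 2 * x 7 * z 13 + x 6 * z 1 - x 9 * z 3,
    -x 2 * x 7 * z 10 + x 2 * x 4 * z 12 - x 9 * z 0 + x 0 * z 1 - x 3 * z 7, 0], fun k => ?_⟩
  rw [vecMul_syzygyMatrix]
  fin_cases k <;> simp [minimalRelation]
  · linear_combination -x 3 * h1 - x 2 * x 7 * h3
  · ring
  · linear_combination x 2 * x 7 * h7
  · ring
  · linear_combination -x 6 * h0 + x 5 * h1 + x 9 * h2 - x 2 * x 7 * h4 - x 2 * x 8 * h5 - x 2 * x 4 * h7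
  · linear_combination x 9 * h0 + x 3 * h2 - x 2 * x 8 * h3 - x 2 * x 7 * h6
  · ring
  · linear_combination x 9 * h1 + x 2 * x 7 * h5
  · linear_combination x 9 * h7
  · linear_combination -x 8 * h1 - x 7 * h2 - x 9 * h4 - x 5 * h5 - x 6 * h6 - x 0 * h7
  · linear_combination x 9 * h3 - x 3 * h5
  · linear_combination x 7 * h0 - x 5 * h3 - x 3 * h4 + x 9 * h6
  · ring
  · ring
  · linear_combination x 7 * h1 - x 6 * h3 - x 9 * h5
  · linear_combination x 3 * h7

end Complex

/-! ### Self-duality of the complex. -/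

lemma exists_eq_add_three {α : Type*} (z : Fin 9 → α) : ∃ z' : Fin 9 → α, z = fun j => z' (j + 3) :=
  ⟨fun j => z (j - 3), by simp⟩

section Complex

variable {R : Type*} [CommRing R] (x : Fin 10 → R)

lemma minimalRelation_vecMul : minimalRelation x ᵥ* syzygyMatrix x = 0 := by
  rw [vecMul_syzygyMatrix]
  ext k
  fin_cases k <;> simp [minimalRelation] <;> ring

/-- The rows of `syzygyMatrix` span an isotropic submodule for the symmetric form pairing the
coordinates `k` and `k + 8` of `Fin 16`. This lets its shifted transpose serve as the third
differential. -/
lemma syzygyMatrix_mulVec_vecMul (z : Fin 9 → R) :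
    (syzygyMatrix x *ᵥ fun k => (z ᵥ* syzygyMatrix x) (k + 8)) = 0 := by
  rw [syzygyMatrix_mulVec, vecMul_syzygyMatrix]
  ext k
  fin_cases k <;> simp <;> ring

/-- The matrix of the first differential. -/
def relationMatrix : Matrix (Fin 1) (Fin 9) R := Matrix.of fun _ => minimalRelation x

/-- The matrix of the third differential: the second one is self-dual. -/
def dualSyzygyMatrix : Matrix (Fin 16) (Fin 9) R :=
  (syzygyMatrix x)ᵀ.submatrix (· + 8) (· + 3)

/-- The matrix of the fourth differential, dual to the first one. -/
def dualRelationMatrix : Matrix (Fin 9) (Fin 1) R :=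
  Matrix.of fun i _ => minimalRelation x (i + 3)

lemma relationMatrix_mulVec (z : Fin 9 → R) (i : Fin 1) :
    (relationMatrix x *ᵥ z) i = minimalRelation x ⬝ᵥ z := rfl

lemma dualSyzygyMatrix_mulVec (z : Fin 9 → R) :
    (dualSyzygyMatrix x *ᵥ fun j => z (j + 3)) = fun k => (z ᵥ* syzygyMatrix x) (k + 8) := by
  ext k
  simp only [Matrix.mulVec, Matrix.vecMul, dotProduct, dualSyzygyMatrix, Matrix.submatrix_apply,
    Matrix.transpose_apply]
  exact Fintype.sum_equiv (Equiv.addRight (3 : Fin 9)) _ _ fun _ => mul_comm _ _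

lemma dualRelationMatrix_mulVec (c : R) :
    (dualRelationMatrix x *ᵥ fun _ => c) = fun i => c * minimalRelation x (i + 3) := by
  ext i
  simp [Matrix.mulVec, dotProduct, dualRelationMatrix, mul_comm]

lemma relationMatrix_mul_syzygyMatrix (z : Fin 16 → R) :
    relationMatrix x *ᵥ (syzygyMatrix x *ᵥ z) = 0 := by
  ext i
  rw [relationMatrix_mulVec, Matrix.dotProduct_mulVec, minimalRelation_vecMul, zero_dotProduct]
  rfl

lemma syzygyMatrix_mul_dualSyzygyMatrix (z : Fin 9 → R) :
    syzygyMatrix x *ᵥ (dualSyzygyMatrix x *ᵥ z) = 0 := by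
  obtain ⟨z, rfl⟩ := exists_eq_add_three z
  rw [dualSyzygyMatrix_mulVec, syzygyMatrix_mulVec_vecMul]

lemma dualSyzygyMatrix_mul_dualRelationMatrix (z : Fin 1 → R) :
    dualSyzygyMatrix x *ᵥ (dualRelationMatrix x *ᵥ z) = 0 := by
  have hz : z = fun _ => z 0 := by ext i; rw [Subsingleton.elim i 0]
  rw [hz, dualRelationMatrix_mulVec]
  have h := dualSyzygyMatrix_mulVec x (z 0 • minimalRelation x)
  rw [Matrix.smul_vecMul, minimalRelation_vecMul] at h
  simpa [funext_iff] using h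

end Complex

/-! ### Exactness of the complex over the polynomial ring -/

section Exact

variable (K : Type u) [Field K]

/-- The variables, with the third one halved. -/
def halved : Fin 10 → PolyRing K :=
  ![X 0, X 1, C (1 / 2) * X 2, X 3, X 4, X 5, X 6, X 7, X 8, X 9]

lemma relation_castSucc (i : Fin 9) : relation K i.castSucc = minimalRelation (halved K) i := by
  fin_cases i <;> simp [relation, minimalRelation, halved] <;> ring

/-- The tenth displayed relation is redundant, which is why `F₁` has rank nine. -/
lemma relation_last : relation K (Fin.last 9) =
    X 0 * minimalRelation (halved K) 2 - X 7 * minimalRelation (halved K) 7 := by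
  simp [relation, minimalRelation, halved, show Fin.last 9 = 9 from rfl]
  ring

lemma span_relation :
    Ideal.span (Set.range (relation K)) = Ideal.span (Set.range (minimalRelation (halved K))) := by
  apply le_antisymm
  · rw [Ideal.span_le]
    rintro _ ⟨i, rfl⟩
    refine Fin.lastCases ?_ (fun i => ?_) i
    · rw [relation_last]
      exact sub_mem (Ideal.mul_mem_left _ _ (Ideal.subset_span ⟨2, rfl⟩))
        (Ideal.mul_mem_left _ _ (Ideal.subset_span ⟨7, rfl⟩))
    · rw [relation_castSucc]
      exact Ideal.subset_span ⟨i, rfl⟩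
  · rw [Ideal.span_le]
    rintro _ ⟨i, rfl⟩
    rw [← relation_castSucc]
    exact Ideal.subset_span ⟨_, rfl⟩

/-- A relation between the diagonal entries of the Gram matrix and the minors. -/
def diagonalRelation : PolyRing K :=
  (X 1 * X 7 ^ 2 + X 3 * X 8 ^ 2 - X 6 * X 4 ^ 2) ^ 2 + C 4 * X 3 * X 6 * X 8 ^ 2 * X 4 ^ 2
    + C 4 * (C (1 / 2) * X 2) * X 8 ^ 2 * X 4 ^ 2 * X 7 ^ 2

variable {K}

lemma diagonalRelation_ne_zero : diagonalRelation K ≠ 0 := by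
  intro h
  have := congrArg (eval ![0, 1, 0, 0, 0, 0, 0, 1, 0, 0]) h
  simp [diagonalRelation] at this

lemma minimalRelation_three_ne_zero : minimalRelation (halved K) 3 ≠ 0 := by
  intro h
  have := congrArg (eval ![0, 0, 0, 0, 0, 1, 0, 0, 0, 0]) h
  simp [minimalRelation, halved] at this

/-- An ideal that contains enough minimal relations contains the diagonal relation. -/
lemma diagonalRelation_mem {I : Ideal (PolyRing K)}
    (h : ∀ i ∈ ({0, 1, 2, 8} : Finset (Fin 9)), minimalRelation (halved K) i ∈ I) :
    diagonalRelation K ∈ I := by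
  have h0 := h 0 (by decide)
  have h1 := h 1 (by decide)
  have h2 := h 2 (by decide)
  have h8 := h 8 (by decide)
  -- The variables 0 and 5 cancel in this combination, and the variable 9 survives only in the term
  -- `-2 * X 4 * X 8 * X 9`. Isolating that term, squaring, and replacing `X 9 ^ 2` by means of
  -- relation 8 removes the variable 9 as well.
  set e := -X 8 * minimalRelation (halved K) 2 - X 4 * minimalRelation (halved K) 0
    + X 7 * minimalRelation (halved K) 1 with he
  have hE : e ∈ I := add_mem (sub_mem (I.mul_mem_left _ h2) (I.mul_mem_left _ h0))
    (I.mul_mem_left _ h1)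
  have : diagonalRelation K = (e + C 4 * X 9 * X 8 * X 4) * e
      - C 4 * X 8 ^ 2 * X 4 ^ 2 * minimalRelation (halved K) 8 := by
    have h4 : (C 4 : PolyRing K) = 4 := map_ofNat C 4
    rw [he, diagonalRelation, h4]
    simp [minimalRelation, halved]
    ring
  rw [this]
  exact sub_mem (I.mul_mem_left _ hE) (I.mul_mem_left _ h8)

lemma X_mem_supported_compl {i j : Fin 10} (h : j ≠ i) :
    (X j : PolyRing K) ∈ supported K ({i}ᶜ : Set (Fin 10)) :=
  X_mem_supported.2 h

lemma C_mem_supported (s : Set (Fin 10)) (a : K) : (C a : PolyRing K) ∈ supported K s :=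
  (supported K s).algebraMap_mem a

lemma diagonalRelation_mem_supported {i : Fin 10} (hi : i ∈ ({0, 5, 9} : Finset (Fin 10))) :
    diagonalRelation K ∈ supported K ({i}ᶜ : Set (Fin 10)) := by
  have hX : ∀ j ∉ ({0, 5, 9} : Finset (Fin 10)),
      (X j : PolyRing K) ∈ supported K ({i}ᶜ : Set (Fin 10)) :=
    fun j hj => X_mem_supported_compl fun h => hj (h ▸ hi)
  unfold diagonalRelation
  repeat' first
    | apply add_mem | apply sub_mem | apply mul_mem | apply pow_mem | apply C_mem_supported
    | exact hX _ (by decide)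

/-- The minimal relation `r` is the difference of an element `c` not involving the variable `i` and
the square of that variable. -/
lemma exists_minimalRelation_eq_sub_sq :
    ∀ p ∈ ({(3, 5), (7, 0), (8, 9)} : Finset (Fin 9 × Fin 10)),
      ∃ c ∈ supported K ({5, 0, 9}ᶜ : Set (Fin 10)),
        minimalRelation (halved K) p.1 = c - X p.2 ^ 2 := by
  have hX : ∀ j ∉ ({5, 0, 9} : Finset (Fin 10)),
      (X j : PolyRing K) ∈ supported K ({5, 0, 9}ᶜ : Set (Fin 10)) :=
    fun j hj => X_mem_supported.2 (by simpa using hj)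
  intro p hp
  simp only [Finset.mem_insert, Finset.mem_singleton] at hp
  rcases hp with rfl | rfl | rfl
  · refine ⟨X 1 * X 6 - C (1 / 2) * X 2 * X 8 ^ 2, ?_, by simp [minimalRelation, halved]⟩
    repeat' first
      | apply sub_mem | apply mul_mem | apply pow_mem | apply C_mem_supported
      | exact hX _ (by decide)
  · refine ⟨-(X 1 * X 3) - C (1 / 2) * X 2 * X 4 ^ 2, ?_, by
      simp [minimalRelation, halved]; ring⟩
    repeat' first
      | apply sub_mem | apply neg_mem | apply mul_mem | apply pow_mem | apply C_mem_supported
      | exact hX _ (by decide)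
  · refine ⟨-(C (1 / 2) * X 2 * X 7 ^ 2) - X 3 * X 6, ?_, by simp [minimalRelation, halved]⟩
    repeat' first
      | apply sub_mem | apply neg_mem | apply mul_mem | apply pow_mem | apply C_mem_supported
      | exact hX _ (by decide)

lemma minimalRelation_mem_supported {p : Fin 9 × Fin 10} {i : Fin 10}
    (hp : p ∈ ({(3, 5), (7, 0), (8, 9)} : Finset (Fin 9 × Fin 10)))
    (hi : i ∈ ({5, 0, 9} : Finset (Fin 10))) (h : p.2 ≠ i) :
    minimalRelation (halved K) p.1 ∈ supported K ({i}ᶜ : Set (Fin 10)) := by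
  obtain ⟨c, hc, he⟩ := exists_minimalRelation_eq_sub_sq (K := K) p hp
  rw [he]
  refine sub_mem (supported_mono ?_ hc) (pow_mem (X_mem_supported_compl h) 2)
  simp only [Set.compl_subset_compl, Set.singleton_subset_iff]
  simpa using hi

lemma mem_span_of_minimalRelation_mul_mem {p : Fin 9 × Fin 10}
    (hp : p ∈ ({(3, 5), (7, 0), (8, 9)} : Finset (Fin 9 × Fin 10))) {s : Set (PolyRing K)}
    (hs : ∀ g ∈ s, g ∈ supported K ({p.2}ᶜ : Set (Fin 10))) (f : PolyRing K)
    (h : minimalRelation (halved K) p.1 * f ∈ Ideal.span s) : f ∈ Ideal.span s := by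
  obtain ⟨c, hc, he⟩ := exists_minimalRelation_eq_sub_sq (K := K) p hp
  rw [he] at h
  refine mem_span_of_monic_mul_mem p.2 hs (supported_mono ?_ hc) h
  simp only [Set.compl_subset_compl, Set.singleton_subset_iff]
  simp only [Finset.mem_insert, Finset.mem_singleton] at hp
  rcases hp with rfl | rfl | rfl <;> simp

lemma dualRelationMatrix_injective :
    Function.Injective (dualRelationMatrix (halved K)).mulVecLin := by
  rw [injective_iff_map_eq_zero]
  intro v hv
  have hz : v = fun _ => v 0 := by ext i; rw [Subsingleton.elim i 0]
  rw [Matrix.mulVecLin_apply, hz, dualRelationMatrix_mulVec] at hv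
  have := congrFun hv 0
  rw [hz]
  ext1
  exact (mul_eq_zero.1 this).resolve_right minimalRelation_three_ne_zero

/-- The homology at `F₃` is killed by relations 3 and 7, a regular sequence since relation 7 is
monic up to sign in the variable 0, which relation 3 lacks. -/
lemma exact_dualRelationMatrix : Function.Exact (dualRelationMatrix (halved K)).mulVecLin
    (dualSyzygyMatrix (halved K)).mulVecLin := by
  intro z
  refine ⟨fun hz => ?_, ?_⟩
  · obtain ⟨z, rfl⟩ := exists_eq_add_three z
    rw [Matrix.mulVecLin_apply, dualSyzygyMatrix_mulVec] at hz
    have hz' : z ᵥ* syzygyMatrix (halved K) = 0 := by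
      ext1 k
      simpa using congrFun hz (k - 8)
    refine mem_range_of_smul_mem_two _ dualRelationMatrix_injective minimalRelation_three_ne_zero
      (mem_span_of_minimalRelation_mul_mem (p := (7, 0)) (by decide) ?_) ⟨fun _ => z 3, ?_⟩
      ⟨fun _ => z 7, ?_⟩
    · rintro _ rfl
      exact minimalRelation_mem_supported (p := (3, 5)) (by decide) (by decide) (by decide)
    · rw [Matrix.mulVecLin_apply, dualRelationMatrix_mulVec]
      ext1 i
      simpa using (congrFun (minimalRelation_smul_eq_3 _ hz') (i + 3)).symm
    · rw [Matrix.mulVecLin_apply, dualRelationMatrix_mulVec]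
      ext1 i
      simpa using (congrFun (minimalRelation_smul_eq_7 _ hz') (i + 3)).symm
  · rintro ⟨y, rfl⟩
    exact dualSyzygyMatrix_mul_dualRelationMatrix _ y

lemma exact_dualSyzygyMatrix : Function.Exact (dualSyzygyMatrix (halved K)).mulVecLin
    (syzygyMatrix (halved K)).mulVecLin := by
  intro z
  refine ⟨fun hz => ?_, ?_⟩
  · have key : ∀ {c : PolyRing K}, (∃ y, ∀ k, (y ᵥ* syzygyMatrix (halved K)) (k + 8) = c * z k) →
        c • z ∈ LinearMap.range (dualSyzygyMatrix (halved K)).mulVecLin := by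
      rintro c ⟨y, hy⟩
      refine ⟨fun j => y (j + 3), ?_⟩
      rw [Matrix.mulVecLin_apply, dualSyzygyMatrix_mulVec]
      exact funext hy
    refine mem_range_of_smul_mem_three _ _ dualRelationMatrix_injective exact_dualRelationMatrix
      minimalRelation_three_ne_zero
      (mem_span_of_minimalRelation_mul_mem (p := (7, 0)) (by decide) ?_)
      (mem_span_of_minimalRelation_mul_mem (p := (8, 9)) (by decide) ?_)
      (key (exists_vecMul_syzygyMatrix_eq_3 _ hz)) (key (exists_vecMul_syzygyMatrix_eq_7 _ hz))
      (key (exists_vecMul_syzygyMatrix_eq_8 _ hz))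
    · rintro _ rfl
      exact minimalRelation_mem_supported (p := (3, 5)) (by decide) (by decide) (by decide)
    · rintro _ (rfl | rfl)
      · exact minimalRelation_mem_supported (p := (3, 5)) (by decide) (by decide) (by decide)
      · exact minimalRelation_mem_supported (p := (7, 0)) (by decide) (by decide) (by decide)
  · rintro ⟨y, rfl⟩
    exact syzygyMatrix_mul_dualSyzygyMatrix _ y

/-- Here a regular sequence of length four is needed. `diagonalRelation` comes first because it only
has to be nonzero there and avoids the variables 5, 0, 9 in which the other three members are monic
up to sign. -/
lemma exact_syzygyMatrix : Function.Exact (syzygyMatrix (halved K)).mulVecLin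
    (relationMatrix (halved K)).mulVecLin := by
  intro z
  refine ⟨fun hz => ?_, ?_⟩
  · have hz' : minimalRelation (halved K) ⬝ᵥ z = 0 := congrFun hz 0
    -- The ideal of all multipliers that send `z` into the range.
    set I : Ideal (PolyRing K) :=
      (LinearMap.range (syzygyMatrix (halved K)).mulVecLin).comap
        (LinearMap.toSpanSingleton (PolyRing K) _ z) with hI
    have h3 : minimalRelation (halved K) 3 ∈ I := exists_syzygyMatrix_mulVec_eq_smul_3 _ hz'
    have h7 : minimalRelation (halved K) 7 ∈ I := exists_syzygyMatrix_mulVec_eq_smul_7 _ hz'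
    have h8 : minimalRelation (halved K) 8 ∈ I := exists_syzygyMatrix_mulVec_eq_smul_8 _ hz'
    have hd : diagonalRelation K ∈ I := by
      refine diagonalRelation_mem fun i hi => ?_
      simp only [Finset.mem_insert, Finset.mem_singleton] at hi
      rcases hi with rfl | rfl | rfl | rfl
      · exact exists_syzygyMatrix_mulVec_eq_smul_0 _ hz'
      · exact exists_syzygyMatrix_mulVec_eq_smul_1 _ hz'
      · exact exists_syzygyMatrix_mulVec_eq_smul_2 _ hz'
      · exact h8
    refine mem_range_of_smul_mem_four _ _ _ dualRelationMatrix_injective exact_dualRelationMatrix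
      exact_dualSyzygyMatrix diagonalRelation_ne_zero
      (mem_span_of_minimalRelation_mul_mem (p := (3, 5)) (by decide) ?_)
      (mem_span_of_minimalRelation_mul_mem (p := (7, 0)) (by decide) ?_)
      (mem_span_of_minimalRelation_mul_mem (p := (8, 9)) (by decide) ?_) hd h3 h7 h8
    · rintro _ rfl
      exact diagonalRelation_mem_supported (by decide)
    · rintro _ (rfl | rfl)
      · exact diagonalRelation_mem_supported (by decide)
      · exact minimalRelation_mem_supported (p := (3, 5)) (by decide) (by decide) (by decide)
    · rintro _ (rfl | rfl | rfl)
      · exact diagonalRelation_mem_supported (by decide)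
      · exact minimalRelation_mem_supported (p := (3, 5)) (by decide) (by decide) (by decide)
      · exact minimalRelation_mem_supported (p := (7, 0)) (by decide) (by decide) (by decide)
  · rintro ⟨y, rfl⟩
    exact relationMatrix_mul_syzygyMatrix _ y

end Exact

/-- A property of pairs of an element and a degree holds for the entries of the syzygy matrix if it
holds for the terms that occur in it. -/
lemma syzygyMatrix_induction {R : Type*} [CommRing R] {x : Fin 10 → R} (P : R → ℕ → Prop)
    (h0 : ∀ n, P 0 n) (hx : ∀ i, P (x i) (weight i)) (hn : ∀ i, P (-x i) (weight i))
    (h2 : ∀ i j, P (x i * x j) (weight i + weight j))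
    (h2' : ∀ i j, P (-x i * x j) (weight i + weight j)) (i : Fin 9) (j : Fin 16) :
    P (syzygyMatrix x i j) ((twists 2).get j - (twists 1).get i) := by
  fin_cases i <;> fin_cases j <;>
    first | exact h0 _ | exact hx _ | exact hn _ | exact h2 _ _ | exact h2' _ _

/-! ### Homogeneity and minimality of the complex -/

section Graded

variable {K : Type u} [Field K] {σ : Type} {w : σ → ℕ}

lemma mem_irrelevantIdeal_of_isWeightedHomogeneous {f : MvPolynomial σ K} {n : ℕ}
    (hf : IsWeightedHomogeneous w f n) (hn : 0 < n) : f ∈ irrelevantIdeal K σ := by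
  rw [irrelevantIdeal, ← Set.image_univ, mem_ideal_span_X_image]
  intro m hm
  by_contra! h
  have hm0 : m = 0 := Finsupp.ext fun i => h i (Set.mem_univ i)
  have := hf (mem_support_iff.1 hm)
  rw [hm0] at this
  simp at this
  omega

lemma mem_twistPiece_mul {a b n : ℕ} (hab : a < b) {f g : MvPolynomial σ K}
    (hf : IsWeightedHomogeneous w f (b - a)) (hg : g ∈ twistPiece w b n) :
    f * g ∈ twistPiece w a n := by
  unfold twistPiece at hg ⊢
  split_ifs at hg with h
  · rw [if_pos (by omega), mem_weightedHomogeneousSubmodule]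
    rw [mem_weightedHomogeneousSubmodule] at hg
    have := hf.mul hg
    rwa [show b - a + (n - b) = n - a by omega] at this
  · rw [(Submodule.mem_bot K).1 hg, mul_zero]
    exact zero_mem _

lemma mulVec_mem_freePiece {s t : List ℕ}
    {A : Matrix (Fin s.length) (Fin t.length) (MvPolynomial σ K)}
    (hA : ∀ i j, s.get i < t.get j ∧ IsWeightedHomogeneous w (A i j) (t.get j - s.get i)) {n : ℕ}
    {v : FreeModule K σ t} (hv : v ∈ freePiece w t n) : A *ᵥ v ∈ freePiece w s n := by
  intro i _
  change ∑ j, A i j * v j ∈ twistPiece w (s.get i) n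
  exact sum_mem fun j _ => mem_twistPiece_mul (hA i j).1 (hA i j).2 (hv j (Set.mem_univ j))

lemma mulVec_mem_irrelevantIdeal_smul {s t : List ℕ}
    {A : Matrix (Fin s.length) (Fin t.length) (MvPolynomial σ K)}
    (hA : ∀ i j, s.get i < t.get j ∧ IsWeightedHomogeneous w (A i j) (t.get j - s.get i))
    (v : FreeModule K σ t) : A *ᵥ v ∈ irrelevantIdeal K σ •
      (⊤ : Submodule (MvPolynomial σ K) (FreeModule K σ s)) := by
  rw [pi_eq_sum_univ' (A *ᵥ v)]
  refine sum_mem fun i _ => Submodule.smul_mem_smul ?_ trivial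
  change ∑ j, A i j * v j ∈ irrelevantIdeal K σ
  refine sum_mem fun j _ => ?_
  exact Ideal.mul_mem_right _ _ (mem_irrelevantIdeal_of_isWeightedHomogeneous (hA i j).2
    (Nat.sub_pos_of_lt (hA i j).1))

variable {x : Fin 10 → PolyRing K}

lemma isWeightedHomogeneous_minimalRelation
    (hx : ∀ i, IsWeightedHomogeneous weight (x i) (weight i)) (j : Fin 9) :
    IsWeightedHomogeneous weight (minimalRelation x j) ((twists 1).get j) := by
  have h2 : ∀ i j, IsWeightedHomogeneous weight (x i * x j) (weight i + weight j) :=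
    fun i j => (hx i).mul (hx j)
  have h2' : ∀ i j, IsWeightedHomogeneous weight (-x i * x j) (weight i + weight j) :=
    fun i j => (hx i).neg.mul (hx j)
  have hs : ∀ i, IsWeightedHomogeneous weight (x i ^ 2) (2 * weight i) := fun i => (hx i).pow 2
  have h3 : ∀ i j k, IsWeightedHomogeneous weight (x i * x j * x k)
      (weight i + weight j + weight k) := fun i j k => (h2 i j).mul (hx k)
  have h3' : ∀ i j, IsWeightedHomogeneous weight (x i * x j ^ 2) (weight i + 2 * weight j) :=
    fun i j => (hx i).mul (hs j)
  fin_cases j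
  · exact ((h2' 4 6).add (h2 5 7)).add (h2 8 9)
  · exact ((h2' 0 8).sub (h2 1 7)).add (h2 4 5)
  · exact ((h2' 0 7).add (h2 3 8)).add (h2 4 9)
  · exact ((h2 1 6).sub (h3' 2 8)).sub (hs 5)
  · exact ((h2' 0 9).sub (h3 2 4 7)).sub (h2 3 5)
  · exact ((h2' 0 5).add (h2 1 9)).sub (h3 2 4 8)
  · exact ((h2' 0 6).sub (h3 2 7 8)).add (h2 5 9)
  · exact ((hs 0).neg.sub (h2 1 3)).sub (h3' 2 4)
  · exact (((hx 2).neg.mul (hs 7)).sub (h2 3 6)).sub (hs 9)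

lemma isWeightedHomogeneous_syzygyMatrix
    (hx : ∀ i, IsWeightedHomogeneous weight (x i) (weight i)) (i : Fin 9) (j : Fin 16) :
    IsWeightedHomogeneous weight (syzygyMatrix x i j) ((twists 2).get j - (twists 1).get i) :=
  syzygyMatrix_induction (IsWeightedHomogeneous weight) (isWeightedHomogeneous_zero K weight) hx
    (fun i => (hx i).neg) (fun i j => (hx i).mul (hx j)) (fun i j => (hx i).neg.mul (hx j)) i j

end Graded

end Complex

/-! ### Monomials on the rational normal scroll of type `(1, 1, 2)` -/

section Scroll

/-- The multidegree of a monomial in `s c, t c, s w, t w, s² b, s t b, t² b`: its degrees in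
`c`, `w`, `b` and `s`. -/
def scrollDegree (a : Fin 7 → ℕ) : Fin 4 → ℕ :=
  ![a 0 + a 1, a 2 + a 3, a 4 + a 5 + a 6, a 0 + a 2 + 2 * a 4 + a 5]

lemma scrollDegree_add (a a' : Fin 7 → ℕ) :
    scrollDegree (a + a') = scrollDegree a + scrollDegree a' := by
  ext i
  fin_cases i <;> simp [scrollDegree] <;> ring

lemma scrollDegree_eq_iff {a a' : Fin 7 → ℕ} : scrollDegree a = scrollDegree a' ↔
    a 0 + a 1 = a' 0 + a' 1 ∧ a 2 + a 3 = a' 2 + a' 3 ∧ a 4 + a 5 + a 6 = a' 4 + a' 5 + a' 6 ∧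
      a 0 + a 2 + 2 * a 4 + a 5 = a' 0 + a' 2 + 2 * a' 4 + a' 5 := by
  simp [scrollDegree, funext_iff, Fin.forall_fin_succ]

variable {M : Type*} [CommMonoid M]

/-- The monomial with exponents `a` in the elements `y`. -/
def scrollMonomial (y : Fin 7 → M) (a : Fin 7 → ℕ) : M := ∏ i, y i ^ a i

lemma scrollMonomial_add (y : Fin 7 → M) (a a' : Fin 7 → ℕ) :
    scrollMonomial y (a + a') = scrollMonomial y a * scrollMonomial y a' := by
  simp [scrollMonomial, pow_add, Finset.prod_mul_distrib]

lemma scrollMonomial_single (y : Fin 7 → M) (i : Fin 7) :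
    scrollMonomial y (Pi.single i 1) = y i := by
  rw [scrollMonomial, Finset.prod_eq_single i] <;> simp +contextual

/-- The two-by-two minors of the matrix with rows `s c, s w, s² b, s t b` and
`t c, t w, s t b, t² b` vanish. -/
structure IsScroll (y : Fin 7 → M) : Prop where
  wc : y 2 * y 1 = y 0 * y 3
  bc : y 4 * y 1 = y 0 * y 5
  bc' : y 5 * y 1 = y 0 * y 6
  bw : y 4 * y 3 = y 2 * y 5
  bw' : y 5 * y 3 = y 2 * y 6
  bb : y 5 * y 5 = y 4 * y 6

/-- Monomials of the same multidegree agree on the scroll. -/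
theorem IsScroll.scrollMonomial_eq {y : Fin 7 → M} (hy : IsScroll y) {a a' : Fin 7 → ℕ}
    (h : scrollDegree a = scrollDegree a') : scrollMonomial y a = scrollMonomial y a' := by
  obtain ⟨N, hN⟩ : ∃ N, ∑ i, a i = N := ⟨_, rfl⟩
  induction N generalizing a a' with
  | zero =>
    have ha : a = 0 := funext fun i => (Finset.sum_eq_zero_iff.1 hN) i (Finset.mem_univ i)
    have ha' : a' = 0 := by
      subst ha
      rw [scrollDegree_eq_iff] at h
      simp at h
      ext i
      fin_cases i <;> simp <;> omega
    rw [ha, ha']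
  | succ N ih =>
    -- A shared factor can be split off, which lowers the number of factors.
    have common : ∀ i (a a' : Fin 7 → ℕ), 0 < a i → 0 < a' i → scrollDegree a = scrollDegree a' →
        ∑ i, a i = N + 1 → scrollMonomial y a = scrollMonomial y a' := by
      intro i a a' hi hi' h hN
      have split : ∀ a : Fin 7 → ℕ, 0 < a i → ∃ r : Fin 7 → ℕ, a = Pi.single i 1 + r := by
        refine fun a hi => exists_add_of_le fun j => ?_
        rcases eq_or_ne j i with rfl | hj
        · simpa using Nat.succ_le_of_lt hi
        · simp [hj]
      obtain ⟨r, rfl⟩ := split a hi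
      obtain ⟨r', rfl⟩ := split a' hi'
      rw [scrollDegree_add, scrollDegree_add] at h
      rw [scrollMonomial_add, scrollMonomial_add, ih (add_left_cancel h)]
      simp only [Pi.add_apply, Finset.sum_add_distrib, Finset.sum_pi_single', Finset.mem_univ,
        if_true] at hN
      omega
    -- One minor relation, applied to `a'`, creates a factor `y k` shared with `a`.
    have move : ∀ {i j k l : Fin 7} (a a' : Fin 7 → ℕ), y i * y j = y k * y l →
        scrollDegree (Pi.single i 1 + Pi.single j 1) =
          scrollDegree (Pi.single k 1 + Pi.single l 1) →
        0 < a k → Pi.single i 1 + Pi.single j 1 ≤ a' → scrollDegree a = scrollDegree a' →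
        ∑ i, a i = N + 1 → scrollMonomial y a = scrollMonomial y a' := by
      intro i j k l a a' hy hd hk ha' h hN
      obtain ⟨r, rfl⟩ := exists_add_of_le ha'
      have e : scrollMonomial y (Pi.single i 1 + Pi.single j 1 + r) =
          scrollMonomial y (Pi.single k 1 + Pi.single l 1 + r) := by
        simp only [scrollMonomial_add, scrollMonomial_single, hy]
      rw [e]
      refine common k _ _ hk (by simp [add_assoc]) ?_ hN
      rw [h, scrollDegree_add, hd, ← scrollDegree_add]
    -- In each case `a` contains the factor `s c`, `s w` or `s² b` and `a'` does not. Equality of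
    -- the degrees in `c`, `w`, `b` and `s` forces `a'` to contain two factors that a minor
    -- exchanges for it.
    have main : ∀ a a' : Fin 7 → ℕ, scrollDegree a = scrollDegree a' → ∑ i, a i = N + 1 →
        (0 < a 0 ∧ a' 0 = 0) ∨ (a 0 = 0 ∧ a' 0 = 0 ∧ 0 < a 2 ∧ a' 2 = 0) ∨
          (a 0 = 0 ∧ a' 0 = 0 ∧ a 2 = 0 ∧ a' 2 = 0 ∧ 0 < a 4 ∧ a' 4 = 0 ∧ a 5 = 0) →
        scrollMonomial y a = scrollMonomial y a' := by
      intro a a' h hN hc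
      have h' := scrollDegree_eq_iff.1 h
      have le : ∀ {i j : Fin 7}, i ≠ j → 0 < a' i → 0 < a' j →
          (Pi.single i 1 + Pi.single j 1 : Fin 7 → ℕ) ≤ a' := by
        intro i j hij hi hj m
        rcases eq_or_ne m i with rfl | hmi
        · simpa [hij] using Nat.succ_le_of_lt hi
        · rcases eq_or_ne m j with rfl | hmj
          · simpa [hmi] using Nat.succ_le_of_lt hj
          · simp [hmi, hmj]
      rcases hc with ⟨h0, h0'⟩ | ⟨h0, h0', h2, h2'⟩ | ⟨h0, h0', h2, h2', h4, h4', h5⟩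
      · have h1' : 0 < a' 1 := by omega
        rcases Nat.eq_zero_or_pos (a' 2) with h2 | h2
        · rcases Nat.eq_zero_or_pos (a' 4) with h4 | h4
          · exact move a a' hy.bc' (by decide) h0 (le (by decide) (by omega) h1') h hN
          · exact move a a' hy.bc (by decide) h0 (le (by decide) h4 h1') h hN
        · exact move a a' hy.wc (by decide) h0 (le (by decide) h2 h1') h hN
      · have h3' : 0 < a' 3 := by omega
        rcases Nat.eq_zero_or_pos (a' 4) with h4 | h4
        · exact move a a' hy.bw' (by decide) h2 (le (by decide) (by omega) h3') h hN
        · exact move a a' hy.bw (by decide) h2 (le (by decide) h4 h3') h hN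
      -- With no other source of `s` left, the degree in `s` gives `a' 5 = 2 * a 4`, so `a'`
      -- contains `s t b` at least twice.
      · refine move a a' hy.bb (by decide) h4 ?_ h hN
        intro m
        rcases eq_or_ne m 5 with rfl | hm
        · simp
          omega
        · simp [hm]
    have hN' : ∑ i, a' i = N + 1 := by
      rw [← hN]
      rw [scrollDegree_eq_iff] at h
      simp only [Fin.sum_univ_seven]
      omega
    by_cases hc : ∃ i, 0 < a i ∧ 0 < a' i
    · obtain ⟨i, hi, hi'⟩ := hc
      exact common i a a' hi hi' h hN
    · have hc' : ∀ i, a i = 0 ∨ a' i = 0 := fun i => by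
        by_contra! hi
        exact hc ⟨i, by omega, by omega⟩
      obtain ⟨e₀, e₂, e₄, e⟩ := scrollDegree_eq_iff.1 h
      rcases Nat.eq_zero_or_pos (a 0) with h0 | h0
      · rcases Nat.eq_zero_or_pos (a' 0) with h0' | h0'
        · rcases Nat.eq_zero_or_pos (a 2) with h2 | h2
          · rcases Nat.eq_zero_or_pos (a' 2) with h2' | h2'
            · rcases Nat.eq_zero_or_pos (a 4) with h4 | h4
              · rcases Nat.eq_zero_or_pos (a' 4) with h4' | h4'
                · have := hc' 1
                  have := hc' 3
                  have := hc' 5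
                  have := hc' 6
                  simp only [Fin.sum_univ_seven] at hN
                  omega
                · have := hc' 5
                  exact (main a' a h.symm hN' (.inr (.inr
                    ⟨h0', h0, h2', h2, h4', h4, by omega⟩))).symm
              · have := hc' 5
                have h4' := (hc' 4).resolve_left h4.ne'
                exact main a a' h hN (.inr (.inr ⟨h0, h0', h2, h2', h4, h4', by omega⟩))
            · exact (main a' a h.symm hN' (.inr (.inl ⟨h0', h0, h2', h2⟩))).symm
          · exact main a a' h hN (.inr (.inl ⟨h0, h0', h2, (hc' 2).resolve_left h2.ne'⟩))
        · exact (main a' a h.symm hN' (.inl ⟨h0', h0⟩)).symm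
      · exact main a a' h hN (.inl ⟨h0, (hc' 0).resolve_left h0.ne'⟩)

/-- The exponents of `s, t, b, c, w` in a monomial in `s c, t c, s w, t w, s² b, s t b, t² b`. -/
def IsLift (n : Fin 7 →₀ ℕ) (a : Fin 7 → ℕ) : Prop :=
  n 0 = a 0 + a 2 + 2 * a 4 + a 5 ∧ n 1 = a 1 + a 3 + a 5 + 2 * a 6 ∧ n 2 = a 4 + a 5 + a 6 ∧
    n 3 = a 0 + a 1 ∧ n 4 = a 2 + a 3

/-- The factors `s` are handed out greedily, to the `w`s, then to the `c`s, and what remains in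
pairs to the `b`s; the factors `t` fill the vacant places. -/
lemma exists_lift {i j b c w : ℕ} (h : i + j = 2 * b + c + w) : ∃ a : Fin 7 → ℕ,
    i = a 0 + a 2 + 2 * a 4 + a 5 ∧ j = a 1 + a 3 + a 5 + 2 * a 6 ∧ b = a 4 + a 5 + a 6 ∧
      c = a 0 + a 1 ∧ w = a 2 + a 3 := by
  obtain ⟨w₁, w₂, i₁, hw, hi, hw₂⟩ : ∃ w₁ w₂ i₁, w = w₁ + w₂ ∧ i = w₁ + i₁ ∧ (i₁ = 0 ∨ w₂ = 0) := by
    rcases le_total i w with h | h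
    · exact ⟨i, w - i, 0, by omega, by omega, Or.inl rfl⟩
    · exact ⟨w, 0, i - w, by omega, by omega, Or.inr rfl⟩
  obtain ⟨c₁, c₂, i₂, hc, hi₁, hc₂⟩ : ∃ c₁ c₂ i₂, c = c₁ + c₂ ∧ i₁ = c₁ + i₂ ∧
      (i₂ = 0 ∨ c₂ = 0) := by
    rcases le_total i₁ c with h | h
    · exact ⟨i₁, c - i₁, 0, by omega, by omega, Or.inl rfl⟩
    · exact ⟨c, 0, i₁ - c, by omega, by omega, Or.inr rfl⟩
  refine ⟨![c₁, c₂, w₁, w₂, i₂ / 2, i₂ % 2, b - i₂ / 2 - i₂ % 2], ?_⟩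
  simp
  omega

end Scroll

/-! ### The fibre `L₈ = 0` of the ring of relations -/

section Fibre

variable (K : Type u) [Field K]

/-- The parametrization of the fibre by `s, t, b, c, w, e, d`. -/
def fibreParam : PolyRing K →ₐ[K] MvPolynomial (Fin 7) K :=
  aeval ![X 0 * X 3, X 5, X 6, -(X 0 ^ 2 * X 2), X 0 * X 4, X 1 * X 3, X 1 ^ 2 * X 2, 0, X 1 * X 4,
    X 0 * X 1 * X 2]

/-- The equation satisfied by `b, c, w, e, d`. -/
def fibreEquation : MvPolynomial (Fin 7) K := X 2 * X 5 - X 3 ^ 2 - C (1 / 2) * X 6 * X 4 ^ 2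

/-- The exponents of the image of a monomial under the parametrization. -/
def paramExponent (m : Fin 10 →₀ ℕ) : Fin 7 →₀ ℕ := Finsupp.equivFunOnFinite.symm
  ![m 0 + m 4 + 2 * m 3 + m 9, m 5 + m 8 + m 9 + 2 * m 6, m 3 + m 9 + m 6, m 0 + m 5, m 4 + m 8,
    m 1, m 2]

lemma fibreParam_monomial {m : Fin 10 →₀ ℕ} (h : m 7 = 0) :
    fibreParam K (monomial m 1) = monomial (paramExponent m) ((-1) ^ m 3) := by
  rw [fibreParam, aeval_monomial, monomial_eq, Finsupp.prod_fintype _ _ (by simp),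
    Finsupp.prod_fintype _ _ (by simp)]
  simp only [Fin.prod_univ_succ, paramExponent, Finsupp.equivFunOnFinite_symm_apply_apply]
  simp [h]
  rw [neg_pow (X 0 ^ 2 * X 2 : MvPolynomial (Fin 7) K)]
  ring

variable {Q : Type*} [CommRing Q] [Algebra K Q]

/-- Ten elements of a `K`-algebra that satisfy the relations, the eighth of them being zero. -/
structure IsFibrePoint (v : Fin 10 → Q) : Prop where
  seven : v 7 = 0
  relation : ∀ i, aeval v (minimalRelation (halved K) i) = 0

/-- The generators of the scroll among the variables, with their sign. -/
def scrollVar (v : Fin 10 → Q) : Fin 7 → Q := ![v 0, v 5, v 4, v 8, -v 3, v 9, v 6]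

/-- Once the eighth element is zero, the relations 0, 1, 2, 4, 6, 8 are the six minors up to sign.
-/
lemma IsFibrePoint.isScroll {v : Fin 10 → Q} (hv : IsFibrePoint K v) :
    IsScroll (scrollVar v) := by
  have h7 := hv.seven
  have h0 := hv.relation 0
  have h1 := hv.relation 1
  have h2 := hv.relation 2
  have h4 := hv.relation 4
  have h6 := hv.relation 6
  have h8 := hv.relation 8
  simp [minimalRelation, halved, h7] at h0 h1 h2 h4 h6 h8
  constructor <;> simp only [scrollVar, Matrix.cons_val]
  · linear_combination h1
  · linear_combination h4
  · linear_combination h6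
  · linear_combination -h2
  · linear_combination h0
  · linear_combination -h8

open Classical in
/-- The value of a monomial in `s, t, b, c, w, e, d`, provided that it is a monomial in the images
of the variables. -/
def lowerMonomial (v : Fin 10 → Q) (n : Fin 7 →₀ ℕ) : Q :=
  if h : ∃ a, IsLift n a then v 1 ^ n 5 * v 2 ^ n 6 * scrollMonomial (scrollVar v) h.choose else 0

variable {K} in
-- Any two lifts of a monomial have the same multidegree, so on the scroll the choice of lift does
-- not matter.
lemma IsFibrePoint.lowerMonomial_eq {v : Fin 10 → Q} (hv : IsFibrePoint K v) {n : Fin 7 →₀ ℕ}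
    {a : Fin 7 → ℕ} (h : IsLift n a) :
    lowerMonomial v n = v 1 ^ n 5 * v 2 ^ n 6 * scrollMonomial (scrollVar v) a := by
  have hex : ∃ a, IsLift n a := ⟨a, h⟩
  rw [lowerMonomial, dif_pos hex, hv.isScroll.scrollMonomial_eq]
  obtain ⟨h0, h1, h2, h3, h4⟩ := h
  obtain ⟨h0', h1', h2', h3', h4'⟩ := hex.choose_spec
  rw [scrollDegree_eq_iff]
  omega

/-- Give `s, t` weight 1, `c, w` weight -1, `b` weight -2 and `e, d` weight 0. The images of the
variables have weight 0, so a monomial of nonzero weight has no lift. -/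
lemma lowerMonomial_eq_zero {v : Fin 10 → Q} {n : Fin 7 →₀ ℕ}
    (h : n 0 + n 1 ≠ 2 * n 2 + n 3 + n 4) : lowerMonomial v n = 0 := by
  rw [lowerMonomial, dif_neg]
  rintro ⟨a, h0, h1, h2, h3, h4⟩
  omega

/-- The linear extension of `lowerMonomial`. -/
def lower (v : Fin 10 → Q) : MvPolynomial (Fin 7) K →ₗ[K] Q :=
  (basisMonomials (Fin 7) K).constr K (lowerMonomial v)

lemma lower_monomial (v : Fin 10 → Q) (n : Fin 7 →₀ ℕ) (r : K) :
    lower K v (monomial n r) = algebraMap K Q r * lowerMonomial v n := by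
  have h : monomial n r = r • basisMonomials (Fin 7) K n := by simp [smul_monomial]
  rw [h, map_smul, lower, Module.Basis.constr_basis, Algebra.smul_def]

lemma aeval_monomial_eq_scrollMonomial (v : Fin 10 → Q) {m : Fin 10 →₀ ℕ} (h : m 7 = 0) :
    aeval v (monomial m (1 : K)) = (-1) ^ m 3 * (v 1 ^ m 1 * v 2 ^ m 2 *
      scrollMonomial (scrollVar v) ![m 0, m 5, m 4, m 8, m 3, m 9, m 6]) := by
  rw [aeval_monomial, Finsupp.prod_fintype _ _ (by simp)]
  simp only [scrollMonomial, Fin.prod_univ_succ]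
  simp [h, scrollVar]
  rw [neg_pow (v 3)]
  have h1 : ((-1) ^ m 3 * (-1) ^ m 3 : Q) = 1 := by
    rw [← mul_pow]; simp
  linear_combination (v 0 ^ m 0 * v 1 ^ m 1 * v 2 ^ m 2 * v 3 ^ m 3 * v 4 ^ m 4 * v 5 ^ m 5
    * v 6 ^ m 6 * v 8 ^ m 8 * v 9 ^ m 9) * -h1

variable {K}

/-- Thus evaluation at `v` factors linearly through the parametrization, so anything about `aeval v
F` can be read off from `fibreParam K F`. -/
lemma IsFibrePoint.lower_fibreParam {v : Fin 10 → Q} (hv : IsFibrePoint K v) (F : PolyRing K) :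
    lower K v (fibreParam K F) = aeval v F := by
  suffices h : (lower K v).comp (fibreParam K).toLinearMap = (aeval v).toLinearMap from
    LinearMap.congr_fun h F
  refine (basisMonomials (Fin 10) K).ext fun m => ?_
  simp only [coe_basisMonomials, LinearMap.comp_apply, AlgHom.toLinearMap_apply]
  by_cases hm : m 7 = 0
  · have hl : IsLift (paramExponent m) ![m 0, m 5, m 4, m 8, m 3, m 9, m 6] := by
      simp [IsLift, paramExponent]
    rw [fibreParam_monomial K hm, lower_monomial, hv.lowerMonomial_eq hl,
      aeval_monomial_eq_scrollMonomial K v hm]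
    simp [paramExponent]
  · obtain ⟨F, hF⟩ : X 7 ∣ (monomial m (1 : K) : PolyRing K) := X_dvd_monomial.2 (Or.inr hm)
    rw [hF, map_mul (fibreParam K), map_mul (aeval v), aeval_X, hv.seven]
    simp [fibreParam]

/-- The equation is homogeneous of weight -2. Times a monomial of weight other than 2 its three
terms are all lowered to zero; times one of weight 2 it is a liftable monomial times `s²`, `s t` or
`t²` times the equation, and these are the relations 7, 5, 3. -/
lemma IsFibrePoint.lower_fibreEquation_mul {v : Fin 10 → Q} (hv : IsFibrePoint K v)
    (g : MvPolynomial (Fin 7) K) : lower K v (fibreEquation K * g) = 0 := by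
  suffices h : (lower K v).comp (LinearMap.mulLeft K (fibreEquation K)) = 0 from
    LinearMap.congr_fun h g
  refine (basisMonomials (Fin 7) K).ext fun n => ?_
  simp only [coe_basisMonomials, LinearMap.comp_apply, LinearMap.mulLeft_apply,
    LinearMap.zero_apply]
  set n₁ := n + Finsupp.single 2 1 + Finsupp.single 5 1 with hn₁
  set n₂ := n + Finsupp.single 3 2 with hn₂
  set n₃ := n + Finsupp.single 6 1 + Finsupp.single 4 2 with hn₃
  have e : fibreEquation K * monomial n 1 =
      monomial n₁ 1 - monomial n₂ 1 - monomial n₃ (1 / 2) := by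
    have hC : monomial n (1 / 2 : K) = C (1 / 2) * monomial n 1 := by rw [C_mul_monomial, mul_one]
    simp only [hn₁, hn₂, hn₃, fibreEquation, monomial_add_single, hC]
    ring
  rw [e, map_sub, map_sub, lower_monomial, lower_monomial, lower_monomial, map_one, one_mul,
    one_mul]
  by_cases hb : n 0 + n 1 = 2 * n 2 + n 3 + n 4 + 2
  · have key : ∀ (i j : ℕ) (p q r : Fin 7 → ℕ), i + j = 2 * n 2 + n 3 + n 4 →
        (∀ a : Fin 7 → ℕ, i = a 0 + a 2 + 2 * a 4 + a 5 → j = a 1 + a 3 + a 5 + 2 * a 6 →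
          n 2 = a 4 + a 5 + a 6 → n 3 = a 0 + a 1 → n 4 = a 2 + a 3 →
          IsLift n₁ (a + p) ∧ IsLift n₂ (a + q) ∧ IsLift n₃ (a + r)) →
        scrollMonomial (scrollVar v) p * v 1 - scrollMonomial (scrollVar v) q
          - algebraMap K Q (1 / 2) * v 2 * scrollMonomial (scrollVar v) r = 0 →
        lowerMonomial v n₁ - lowerMonomial v n₂
          - algebraMap K Q (1 / 2) * lowerMonomial v n₃ = 0 := by
      intro i j p q r hij hl hrel
      obtain ⟨a, ha⟩ := exists_lift hij
      obtain ⟨hp, hq, hr⟩ := hl a ha.1 ha.2.1 ha.2.2.1 ha.2.2.2.1 ha.2.2.2.2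
      rw [hv.lowerMonomial_eq hp, hv.lowerMonomial_eq hq, hv.lowerMonomial_eq hr]
      have h1 : n₁ 5 = n 5 + 1 ∧ n₁ 6 = n 6 := by simp [hn₁]
      have h2 : n₂ 5 = n 5 ∧ n₂ 6 = n 6 := by simp [hn₂]
      have h3 : n₃ 5 = n 5 ∧ n₃ 6 = n 6 + 1 := by simp [hn₃]
      rw [h1.1, h1.2, h2.1, h2.2, h3.1, h3.2]
      simp only [scrollMonomial_add, pow_succ]
      linear_combination (v 1 ^ n 5 * v 2 ^ n 6 * scrollMonomial (scrollVar v) a) * hrel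
    have hr3 := hv.relation 3
    have hr5 := hv.relation 5
    have hr7 := hv.relation 7
    simp only [minimalRelation, halved, Matrix.cons_val, map_mul, map_sub, map_add, map_neg,
      map_pow, aeval_X, algHom_C] at hr3 hr5 hr7
    -- The exponent of `s` decides which factor to split off: `t²` if it is 0, `s t` if it is 1,
    -- `s²` otherwise.
    rcases Nat.lt_or_ge (n 0) 2 with h0 | h0
    · rcases Nat.lt_or_ge (n 0) 1 with h0' | h0'
      · refine key (n 0) (n 1 - 2) (Pi.single 6 1) (Pi.single 1 2) (Pi.single 3 2) (by omega)
          (fun a h1 h2 h3 h4 h5 => ?_) ?_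
        · simp [IsLift, hn₁, hn₂, hn₃]
          omega
        · simp only [scrollMonomial, Fin.prod_univ_seven, scrollVar]
          simp [-one_div]
          linear_combination hr3
      · refine key (n 0 - 1) (n 1 - 1) (Pi.single 5 1) (Pi.single 0 1 + Pi.single 1 1)
          (Pi.single 2 1 + Pi.single 3 1) (by omega) (fun a h1 h2 h3 h4 h5 => ?_) ?_
        · simp [IsLift, hn₁, hn₂, hn₃]
          omega
        · simp only [scrollMonomial, Fin.prod_univ_seven, scrollVar]
          simp [-one_div]
          linear_combination hr5
    · refine key (n 0 - 2) (n 1) (Pi.single 4 1) (Pi.single 0 2) (Pi.single 2 2) (by omega)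
          (fun a h1 h2 h3 h4 h5 => ?_) ?_
      · simp [IsLift, hn₁, hn₂, hn₃]
        omega
      · simp only [scrollMonomial, Fin.prod_univ_seven, scrollVar]
        simp [-one_div]
        linear_combination hr7
  · rw [lowerMonomial_eq_zero, lowerMonomial_eq_zero, lowerMonomial_eq_zero]
    · simp
    · simp [hn₃]
      omega
    · simp [hn₂]
      omega
    · simp [hn₁]
      omega

/-- The polynomials that vanish on the image of the parametrization lie in the ideal of the
relations. -/
theorem IsFibrePoint.aeval_eq_zero {v : Fin 10 → Q} (hv : IsFibrePoint K v) {F : PolyRing K}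
    (hF : fibreEquation K ∣ fibreParam K F) : aeval v F = 0 := by
  obtain ⟨g, hg⟩ := hF
  rw [← hv.lower_fibreParam, hg, hv.lower_fibreEquation_mul]

end Fibre

/-! ### Divisibility by the equation of the fibre -/

section Divisibility

variable {K : Type u} [Field K]

/-- The variable `b` is prime and does not divide the equation, which takes the value -1 at the
point with `c = 1` and all other coordinates zero. -/
lemma fibreEquation_dvd_of_dvd_X_mul {g : MvPolynomial (Fin 7) K}
    (h : fibreEquation K ∣ X 2 * g) : fibreEquation K ∣ g := by
  obtain ⟨k, hk⟩ := h
  have hd : (X 2 : MvPolynomial (Fin 7) K) ∣ fibreEquation K * k := ⟨g, hk.symm⟩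
  rcases X_dvd_mul_iff.1 hd with ⟨f, hf⟩ | ⟨f, rfl⟩
  · have := congrArg (eval ![0, 0, 0, 1, 0, 0, 0]) hf
    simp [fibreEquation] at this
  · refine ⟨f, mul_left_cancel₀ (X_ne_zero (2 : Fin 7) : (X 2 : MvPolynomial (Fin 7) K) ≠ 0) ?_⟩
    rw [hk]
    ring

lemma fibreEquation_dvd_of_dvd_X_pow_mul {g : MvPolynomial (Fin 7) K} (N : ℕ)
    (h : fibreEquation K ∣ X 2 ^ N * g) : fibreEquation K ∣ g := by
  induction N with
  | zero => simpa using h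
  | succ N ih =>
    rw [pow_succ', mul_assoc] at h
    exact ih (fibreEquation_dvd_of_dvd_X_mul h)

/-- Modulo the equation of the fibre, the variable `e` can be eliminated after multiplication by a
power of `b`. -/
lemma exists_eliminate (g : MvPolynomial (Fin 7) K) : ∃ (N : ℕ) (g' : MvPolynomial (Fin 7) K),
    (∀ z z' : Fin 7 → K, (∀ i ≠ 5, z i = z' i) → eval z g' = eval z' g') ∧
      fibreEquation K ∣ X 2 ^ N * g - g' := by
  induction g using MvPolynomial.induction_on with
  | C a => exact ⟨0, C a, by simp, by simp⟩
  | add p q hp hq =>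
    obtain ⟨N, p', hp', hp⟩ := hp
    obtain ⟨M, q', hq', hq⟩ := hq
    refine ⟨N + M, X 2 ^ M * p' + X 2 ^ N * q', fun z z' h => ?_, ?_⟩
    · simp [hp' z z' h, hq' z z' h, h 2 (by decide)]
    · have : X 2 ^ (N + M) * (p + q) - (X 2 ^ M * p' + X 2 ^ N * q') =
          X 2 ^ M * (X 2 ^ N * p - p') + X 2 ^ N * (X 2 ^ M * q - q') := by ring
      rw [this]
      exact dvd_add (hp.mul_left _) (hq.mul_left _)
  | mul_X p i hp =>
    obtain ⟨N, p', hp', hp⟩ := hp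
    rcases eq_or_ne i 5 with rfl | hi
    · refine ⟨N + 1, p' * (X 3 ^ 2 + C (1 / 2) * X 6 * X 4 ^ 2), fun z z' h => ?_, ?_⟩
      · simp [hp' z z' h, h 3 (by decide), h 4 (by decide), h 6 (by decide)]
      · have : X 2 ^ (N + 1) * (p * X 5) - p' * (X 3 ^ 2 + C (1 / 2) * X 6 * X 4 ^ 2) =
            (X 2 ^ N * p - p') * (X 2 * X 5) + fibreEquation K * p' := by
          rw [fibreEquation]
          ring
        rw [this]
        exact dvd_add (hp.mul_right _) (Dvd.intro _ rfl)
    · refine ⟨N, p' * X i, fun z z' h => ?_, ?_⟩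
      · simp [hp' z z' h, h i hi]
      · have : X 2 ^ N * (p * X i) - p' * X i = (X 2 ^ N * p - p') * X i := by ring
        rw [this]
        exact hp.mul_right _

/-- A polynomial that vanishes at the points of the hypersurface with `b ≠ 0` is divisible by its
equation. -/
theorem fibreEquation_dvd [CharZero K] {g : MvPolynomial (Fin 7) K}
    (hg : ∀ z : Fin 7 → K, eval z (fibreEquation K) = 0 → z 2 ≠ 0 → eval z g = 0) :
    fibreEquation K ∣ g := by
  obtain ⟨N, g', hg', hd⟩ := exists_eliminate g
  -- As `g'` does not depend on `e`, any point with `b ≠ 0` may be moved onto the hypersurface by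
  -- solving for `e`. The factor `X 2` covers the points with `b = 0`.
  have h0 : X 2 * g' = 0 := by
    refine MvPolynomial.funext fun z => ?_
    rcases eq_or_ne (z 2) 0 with h2 | h2
    · simp [h2]
    · set z' := Function.update z 5 ((z 3 ^ 2 + 1 / 2 * z 6 * z 4 ^ 2) / z 2) with hz'
      have hne : ∀ i ≠ 5, z i = z' i := fun i hi => (Function.update_of_ne hi _ _).symm
      have h5 : z' 5 = (z 3 ^ 2 + 1 / 2 * z 6 * z 4 ^ 2) / z 2 := Function.update_self _ _ _
      have he : eval z' (fibreEquation K) = 0 := by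
        simp only [fibreEquation, map_sub, map_mul, map_pow, eval_X, eval_C, h5,
          ← hne 2 (by decide), ← hne 3 (by decide), ← hne 4 (by decide), ← hne 6 (by decide)]
        field_simp
        ring
      obtain ⟨k, hk⟩ := hd
      have := congrArg (eval z') hk
      rw [map_sub, map_mul, map_mul, he, hg z' he (by rwa [← hne 2 (by decide)]), mul_zero,
        zero_mul, zero_sub, neg_eq_zero] at this
      rw [map_mul, hg' z z' hne, this]
      simp
  have hg0 : g' = 0 := (mul_eq_zero.1 h0).resolve_left (X_ne_zero 2)
  rw [hg0, sub_zero] at hd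
  exact fibreEquation_dvd_of_dvd_X_pow_mul N hd

end Divisibility

/-- A point of `3V₁ ⊕ V₂` given by its coordinates. -/
def point {α : Type*} (x₀ x₁ y₀ y₁ u₀ u₁ v₀ v₁ v₂ : α) : Coord → α
  | ⟨0, i⟩ => (![x₀, x₁] : Fin 2 → α) i
  | ⟨1, i⟩ => (![y₀, y₁] : Fin 2 → α) i
  | ⟨2, i⟩ => (![u₀, u₁] : Fin 2 → α) i
  | ⟨3, i⟩ => (![v₀, v₁, v₂] : Fin 3 → α) i

lemma eq_point {α : Type*} (p : Coord → α) : p = point (p ⟨0, (0 : Fin 2)⟩) (p ⟨0, (1 : Fin 2)⟩)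
    (p ⟨1, (0 : Fin 2)⟩) (p ⟨1, (1 : Fin 2)⟩) (p ⟨2, (0 : Fin 2)⟩) (p ⟨2, (1 : Fin 2)⟩)
    (p ⟨3, (0 : Fin 3)⟩) (p ⟨3, (1 : Fin 3)⟩) (p ⟨3, (2 : Fin 3)⟩) := by
  funext c
  obtain ⟨j, i⟩ := c
  fin_cases j
  · change Fin 2 at i
    fin_cases i <;> rfl
  · change Fin 2 at i
    fin_cases i <;> rfl
  · change Fin 2 at i
    fin_cases i <;> rfl
  · change Fin 3 at i
    fin_cases i <;> rfl

/-! ### The kernel of the presentation -/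

section Kernel

variable (K : Type u) [Field K]

/-- The ideal of the nine minimal relations. -/
def relationIdeal : Ideal (PolyRing K) := Ideal.span (Set.range (minimalRelation (halved K)))

/-- The values of the ten generators at a point. -/
def generatorValue (x₀ x₁ y₀ y₁ u₀ u₁ v₀ v₁ v₂ : K) : Fin 10 → K :=
  ![-x₀ * u₁ * v₁ + x₀ * u₀ * v₂ - x₁ * u₀ * v₁ + x₁ * u₁ * v₀,
    -2 * u₀ * u₁ * v₁ + u₀ ^ 2 * v₂ + u₁ ^ 2 * v₀,
    -2 * v₁ ^ 2 + 2 * v₀ * v₂,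
    -x₁ ^ 2 * v₀ - x₀ ^ 2 * v₂ + 2 * x₀ * x₁ * v₁,
    -x₀ * u₁ + x₁ * u₀,
    y₁ * u₁ * v₀ - y₁ * u₀ * v₁ - y₀ * u₁ * v₁ + y₀ * u₀ * v₂,
    y₁ ^ 2 * v₀ - 2 * y₀ * y₁ * v₁ + y₀ ^ 2 * v₂,
    -x₀ * y₁ + x₁ * y₀,
    -y₀ * u₁ + y₁ * u₀,
    x₀ * y₀ * v₂ - x₀ * y₁ * v₁ - x₁ * y₀ * v₁ + x₁ * y₁ * v₀]

variable {K}

lemma eval_generator (x₀ x₁ y₀ y₁ u₀ u₁ v₀ v₁ v₂ : K) (i : Fin 10) :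
    eval (point x₀ x₁ y₀ y₁ u₀ u₁ v₀ v₁ v₂) (generator K i) =
      generatorValue K x₀ x₁ y₀ y₁ u₀ u₁ v₀ v₁ v₂ i := by
  fin_cases i <;> simp [generator, generatorValue, point]

lemma eval_aeval_generator (F : PolyRing K) (p : Coord → K) :
    eval p (aeval (generator K) F) = eval (fun i => eval p (generator K i)) F := by
  induction F using MvPolynomial.induction_on with
  | C a => simp
  | add p q hp hq => rw [map_add, map_add, map_add, hp, hq]
  | mul_X p i hp => rw [map_mul, map_mul, map_mul, hp, aeval_X, eval_X]

variable [CharZero K]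

lemma presentation_coe (F : PolyRing K) :
    (presentation K F : MvPolynomial Coord K) = aeval (generator K) F := by
  have : (invariantAlgebra K).val.comp (presentation K) = aeval (generator K) := by
    apply MvPolynomial.algHom_ext
    intro i
    simp [presentation]
  exact DFunLike.congr_fun this F

lemma aeval_generator_minimalRelation (i : Fin 9) :
    aeval (generator K) (minimalRelation (halved K) i) = 0 := by
  refine MvPolynomial.funext fun p => ?_
  rw [eval_aeval_generator, eq_point p]
  simp only [eval_generator]
  fin_cases i <;> simp [minimalRelation, halved, generatorValue] <;> ring

lemma relationIdeal_le_ker : relationIdeal K ≤ RingHom.ker (aeval (generator K)) := by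
  rw [relationIdeal, Ideal.span_le]
  rintro _ ⟨i, rfl⟩
  exact aeval_generator_minimalRelation i

/-- If the value of `F` at the generators is divisible by `L₈`, then `F` is a multiple of `x₈` up to
the relations. -/
theorem mem_of_generator_dvd {F : PolyRing K} (hF : generator K 7 ∣ aeval (generator K) F) :
    F ∈ relationIdeal K ⊔ Ideal.span {X 7} := by
  obtain ⟨f, hf⟩ := hF
  have hd : fibreEquation K ∣ fibreParam K F := by
    refine fibreEquation_dvd fun z hz h2 => ?_
    -- The point with `x = s p`, `y = t p`, `p = (1, 0)`, and with `u` and the quadratic form solved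
    -- from `(p,p) = b`, `(p,u) = c`, `[p,u] = w` and `L₃ = d`, the middle coefficient `v₁` being
    -- zero.
    have h := congrArg (eval (point (z 0) 0 (z 1) 0 (z 3 / z 2) (-z 4) (z 6 / (2 * z 2)) 0 (z 2)))
      hf
    rw [map_mul, eval_generator, eval_aeval_generator] at h
    simp only [eval_generator] at h
    have h7 : generatorValue K (z 0) 0 (z 1) 0 (z 3 / z 2) (-z 4) (z 6 / (2 * z 2)) 0 (z 2) 7 = 0 := by
      simp [generatorValue]
    rw [h7, zero_mul] at h
    rw [← h]
    have e5 : z 5 = (z 3 ^ 2 + 1 / 2 * z 6 * z 4 ^ 2) / z 2 := by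
      simp [fibreEquation] at hz
      field_simp
      linear_combination 2 * hz
    have hv : (fun i => eval z (fibreParam K (X i))) =
        generatorValue K (z 0) 0 (z 1) 0 (z 3 / z 2) (-z 4) (z 6 / (2 * z 2)) 0 (z 2) := by
      funext i
      fin_cases i <;> simp [fibreParam, generatorValue]
      all_goals try rw [e5]
      all_goals field_simp
    change eval z (fibreParam K F) = eval (generatorValue K _ _ _ _ _ _ _ _ _) F
    rw [← hv]
    clear hv h hf
    induction F using MvPolynomial.induction_on with
    | C a => simp
    | add p q hp hq => simp [hp, hq]
    | mul_X p i hp => simp [hp]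
  set I := relationIdeal K ⊔ Ideal.span {X 7} with hI
  have hmk : aeval (fun i => Ideal.Quotient.mkₐ K I (X i)) = Ideal.Quotient.mkₐ K I := by
    apply MvPolynomial.algHom_ext
    intro i
    rw [aeval_X]
  -- The universal fibre point: the classes of the variables modulo `J + (x₈)`.
  have hv : IsFibrePoint K fun i => Ideal.Quotient.mkₐ K I (X i) := by
    refine ⟨?_, fun i => ?_⟩
    · exact Ideal.Quotient.eq_zero_iff_mem.2 (Ideal.mem_sup_right (Ideal.subset_span rfl))
    · rw [hmk]
      exact Ideal.Quotient.eq_zero_iff_mem.2 (Ideal.mem_sup_left (Ideal.subset_span ⟨i, rfl⟩))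
  have := hv.aeval_eq_zero hd
  rw [hmk] at this
  exact Ideal.Quotient.eq_zero_iff_mem.1 this

end Kernel

/-! ### Descent along powers of `x₈`. -/

section Kernel

variable {K : Type u} [Field K]

lemma isWeightedHomogeneous_halved (i : Fin 10) :
    IsWeightedHomogeneous weight (halved K i) (weight i) := by
  have hX : ∀ i, IsWeightedHomogeneous weight (X i : PolyRing K) (weight i) := fun i =>
    isWeightedHomogeneous_X K weight i
  fin_cases i <;> first | exact hX _ | exact (hX 2).C_mul _

attribute [local instance] MvPolynomial.weightedGradedAlgebra in
lemma relationIdeal_isHomogeneous :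
    (relationIdeal K).IsHomogeneous (weightedHomogeneousSubmodule K weight) := by
  refine Ideal.homogeneous_span _ _ ?_
  rintro _ ⟨i, rfl⟩
  exact ⟨_, isWeightedHomogeneous_minimalRelation isWeightedHomogeneous_halved i⟩

lemma weightedHomogeneousComponent_X_pow_mul (G : PolyRing K) {k n : ℕ} (h : n < k) :
    weightedHomogeneousComponent weight n (X 7 ^ k * G) = 0 := by
  classical
  refine weightedHomogeneousComponent_eq_zero' n _ fun d hd => ?_
  rw [mem_support_iff, X_pow_eq_monomial, coeff_monomial_mul'] at hd
  have hk : Finsupp.single 7 k ≤ d := by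
    by_contra hc
    simp [hc] at hd
  have hk7 : k ≤ d 7 := by simpa using hk 7
  have : d 7 * weight 7 ≤ Finsupp.weight weight d := by
    rw [Finsupp.weight_apply, Finsupp.sum_fintype _ _ (by simp)]
    exact Finset.single_le_sum (f := fun i => d i • weight i) (fun _ _ => Nat.zero_le _)
      (Finset.mem_univ 7)
  have h7 : weight 7 = 2 := rfl
  rw [h7] at this
  omega

variable [CharZero K]

lemma generator_seven_ne_zero : generator K 7 ≠ 0 := by
  intro h
  have := congrArg (eval (point (0 : K) 1 1 0 0 0 0 0 0)) h
  rw [eval_generator] at this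
  simp [generatorValue] at this

/-- The division step for both the kernel and generation: if `L₈ f` is a polynomial in the
generators, so is `f`. -/
lemma exists_of_generator_mul_eq {F : PolyRing K} {f : MvPolynomial Coord K}
    (h : generator K 7 * f = aeval (generator K) F) :
    ∃ F', F - X 7 * F' ∈ relationIdeal K ∧ aeval (generator K) F' = f := by
  obtain ⟨j, hj, g, hg, rfl⟩ := Submodule.mem_sup.1 (mem_of_generator_dvd ⟨f, h.symm⟩)
  obtain ⟨F', rfl⟩ := Ideal.mem_span_singleton.1 hg
  refine ⟨F', by simpa using hj, ?_⟩
  have hj0 : aeval (generator K) j = 0 := relationIdeal_le_ker hj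
  rw [map_add, hj0, zero_add, map_mul, aeval_X] at h
  exact (mul_left_cancel₀ generator_seven_ne_zero h).symm

theorem mem_relationIdeal_of_aeval_eq_zero {F : PolyRing K}
    (hF : aeval (generator K) F = 0) : F ∈ relationIdeal K := by
  have key : ∀ k, ∃ G, F - X 7 ^ k * G ∈ relationIdeal K ∧ aeval (generator K) G = 0 := by
    intro k
    induction k with
    | zero => exact ⟨F, by simp, hF⟩
    | succ k ih =>
      obtain ⟨G, hG, hG0⟩ := ih
      obtain ⟨G', hG', hG0'⟩ := exists_of_generator_mul_eq (F := G) (f := 0) (by rw [hG0, mul_zero])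
      refine ⟨G', ?_, hG0'⟩
      have : F - X 7 ^ (k + 1) * G' = (F - X 7 ^ k * G) + X 7 ^ k * (G - X 7 * G') := by ring
      rw [this]
      exact add_mem hG (Ideal.mul_mem_left _ _ hG')
  -- The ideal is homogeneous, and a multiple of `x₈ ^ (n + 1)` has no component of degree `n`; so
  -- membership modulo all powers of `x₈` suffices.
  rw [mem_iff_weightedHomogeneousComponent_mem K weight relationIdeal_isHomogeneous]
  intro n
  obtain ⟨G, hG, -⟩ := key (n + 1)
  have := weightedHomogeneousComponent_mem_of_mem K weight relationIdeal_isHomogeneous hG n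
  rwa [map_sub, weightedHomogeneousComponent_X_pow_mul G (Nat.lt_succ_self n), sub_zero] at this

theorem ker_presentation : RingHom.ker (presentation K) = relationIdeal K := by
  ext F
  rw [RingHom.mem_ker, ← Subtype.coe_inj, presentation_coe]
  exact ⟨mem_relationIdeal_of_aeval_eq_zero, fun h => relationIdeal_le_ker h⟩

end Kernel

/-! ### Generation of the algebra of invariants -/

section Generation

variable {K : Type u} [Field K]

/-- The point to which a point with generator values `l`, `l 7 ≠ 0`, can be moved. -/
def normalPoint (l : Fin 10 → K) : Coord → K :=
  point 0 1 (l 7) 0 (l 4) (-l 8 / l 7) (-l 3) (-l 9 / l 7) (l 6 / l 7 ^ 2)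

/-- The square of `l 7` is a common denominator of the coordinates. -/
lemma exists_eval_normalPoint_X (c : Coord) : ∃ G : PolyRing K, ∀ l : Fin 10 → K, l 7 ≠ 0 →
    l 7 ^ 2 * normalPoint l c = eval l G := by
  obtain ⟨j, i⟩ := c
  fin_cases j
  · change Fin 2 at i
    fin_cases i
    · exact ⟨0, fun l hl => by simp [normalPoint, point]⟩
    · exact ⟨X 7 ^ 2, fun l hl => by simp [normalPoint, point]⟩
  · change Fin 2 at i
    fin_cases i
    · exact ⟨X 7 ^ 3, fun l hl => by simp [normalPoint, point]; ring⟩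
    · exact ⟨0, fun l hl => by simp [normalPoint, point]⟩
  · change Fin 2 at i
    fin_cases i
    · exact ⟨X 7 ^ 2 * X 4, fun l hl => by simp [normalPoint, point]⟩
    · exact ⟨-(X 7 * X 8), fun l hl => by simp [normalPoint, point]; field_simp⟩
  · change Fin 3 at i
    fin_cases i
    · exact ⟨-(X 7 ^ 2 * X 3), fun l hl => by simp [normalPoint, point]⟩
    · exact ⟨-(X 7 * X 9), fun l hl => by simp [normalPoint, point]; field_simp⟩
    · exact ⟨X 6, fun l hl => by simp [normalPoint, point]; field_simp⟩

lemma exists_eval_normalPoint (f : MvPolynomial Coord K) : ∃ (N : ℕ) (G : PolyRing K),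
    ∀ l : Fin 10 → K, l 7 ≠ 0 → l 7 ^ N * eval (normalPoint l) f = eval l G := by
  induction f using MvPolynomial.induction_on with
  | C a => exact ⟨0, C a, fun l _ => by simp⟩
  | add p q hp hq =>
    obtain ⟨N, G, hG⟩ := hp
    obtain ⟨M, H, hH⟩ := hq
    refine ⟨N + M, X 7 ^ M * G + X 7 ^ N * H, fun l hl => ?_⟩
    simp only [map_add, map_mul, map_pow, eval_X, ← hG l hl, ← hH l hl]
    ring
  | mul_X p i hp =>
    obtain ⟨N, G, hG⟩ := hp
    obtain ⟨H, hH⟩ := exists_eval_normalPoint_X (K := K) i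
    refine ⟨N + 2, G * H, fun l hl => ?_⟩
    simp only [map_mul, eval_X, ← hG l hl, ← hH l hl]
    ring

variable [CharZero K]

lemma exists_coordinate_eq {d : ℕ} (a : Fin (d + 1) → K) :
    ∃ F : BinaryForm K d, ∀ i, coordinate F i = a i := by
  refine ⟨⟨∑ i : Fin (d + 1), monomial (Finsupp.single 0 (d - i) + Finsupp.single 1 (i : ℕ))
    ((d.choose i : K) * a i), sum_mem fun i _ => ?_⟩, fun i => ?_⟩
  · rw [mem_homogeneousSubmodule]
    refine isHomogeneous_monomial _ ?_
    rw [map_add, Finsupp.degree_single, Finsupp.degree_single]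
    omega
  · have hc : ((d.choose i : ℕ) : K) ≠ 0 :=
      Nat.cast_ne_zero.2 (Nat.choose_pos (Nat.lt_succ_iff.1 i.2)).ne'
    rw [coordinate, coeff_sum, Finset.sum_eq_single i]
    · rw [coeff_monomial, if_pos rfl, inv_mul_cancel_left₀ hc]
    · intro j _ hj
      rw [coeff_monomial, if_neg]
      intro h
      have := DFunLike.congr_fun h 1
      simp at this
      exact hj (Fin.ext this)
    · simp

lemma exists_coordinates_eq (p : Coord → K) :
    ∃ F : ∀ j, BinaryForm K (degs j), coordinates F = p := by
  choose F hF using fun j => exists_coordinate_eq (K := K) (d := degs j) fun i => p ⟨j, i⟩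
  exact ⟨F, funext fun c => hF c.1 c.2⟩

lemma eval_eq_of_mem_invariantAlgebra {f : MvPolynomial Coord K} (hf : f ∈ invariantAlgebra K)
    {a b c e : K} (h : a * e - b * c = 1) (x₀ x₁ y₀ y₁ u₀ u₁ v₀ v₁ v₂ : K) :
    eval (point (a * x₀ + b * x₁) (c * x₀ + e * x₁) (a * y₀ + b * y₁) (c * y₀ + e * y₁)
        (a * u₀ + b * u₁) (c * u₀ + e * u₁) (a ^ 2 * v₀ + 2 * a * b * v₁ + b ^ 2 * v₂)
        (a * c * v₀ + (a * e + b * c) * v₁ + b * e * v₂)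
        (c ^ 2 * v₀ + 2 * c * e * v₁ + e ^ 2 * v₂)) f =
      eval (point x₀ x₁ y₀ y₁ u₀ u₁ v₀ v₁ v₂) f := by
  obtain ⟨F, hF⟩ := exists_coordinates_eq (point x₀ x₁ y₀ y₁ u₀ u₁ v₀ v₁ v₂)
  have hdet : Matrix.det !![a, b; c, e] = 1 := by rw [Matrix.det_fin_two_of, h]
  have := hf ⟨!![a, b; c, e], hdet⟩ F
  rw [hF] at this
  rw [← this]
  congr 2
  obtain ⟨hx0, hx1⟩ := coordinate_linear (F 0) ⟨!![a, b; c, e], hdet⟩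
  obtain ⟨hy0, hy1⟩ := coordinate_linear (F 1) ⟨!![a, b; c, e], hdet⟩
  obtain ⟨hu0, hu1⟩ := coordinate_linear (F 2) ⟨!![a, b; c, e], hdet⟩
  obtain ⟨hv0, hv1, hv2⟩ := coordinate_quadratic (F 3) ⟨!![a, b; c, e], hdet⟩
  have fx0 : coordinate (d := 1) (F 0) 0 = x₀ := congrFun hF ⟨0, (0 : Fin 2)⟩
  have fx1 : coordinate (d := 1) (F 0) 1 = x₁ := congrFun hF ⟨0, (1 : Fin 2)⟩
  have fy0 : coordinate (d := 1) (F 1) 0 = y₀ := congrFun hF ⟨1, (0 : Fin 2)⟩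
  have fy1 : coordinate (d := 1) (F 1) 1 = y₁ := congrFun hF ⟨1, (1 : Fin 2)⟩
  have fu0 : coordinate (d := 1) (F 2) 0 = u₀ := congrFun hF ⟨2, (0 : Fin 2)⟩
  have fu1 : coordinate (d := 1) (F 2) 1 = u₁ := congrFun hF ⟨2, (1 : Fin 2)⟩
  have fv0 : coordinate (d := 2) (F 3) 0 = v₀ := congrFun hF ⟨3, (0 : Fin 3)⟩
  have fv1 : coordinate (d := 2) (F 3) 1 = v₁ := congrFun hF ⟨3, (1 : Fin 3)⟩
  have fv2 : coordinate (d := 2) (F 3) 2 = v₂ := congrFun hF ⟨3, (2 : Fin 3)⟩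
  rw [fx0, fx1] at hx0 hx1
  rw [fy0, fy1] at hy0 hy1
  rw [fu0, fu1] at hu0 hu1
  rw [fv0, fv1, fv2] at hv0 hv1 hv2
  set p := coordinates fun j => binaryFormRep K (degs j) ⟨!![a, b; c, e], hdet⟩ (F j)
  have px0 : p ⟨0, (0 : Fin 2)⟩ = a * x₀ + b * x₁ := hx0
  have px1 : p ⟨0, (1 : Fin 2)⟩ = c * x₀ + e * x₁ := hx1
  have py0 : p ⟨1, (0 : Fin 2)⟩ = a * y₀ + b * y₁ := hy0
  have py1 : p ⟨1, (1 : Fin 2)⟩ = c * y₀ + e * y₁ := hy1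
  have pu0 : p ⟨2, (0 : Fin 2)⟩ = a * u₀ + b * u₁ := hu0
  have pu1 : p ⟨2, (1 : Fin 2)⟩ = c * u₀ + e * u₁ := hu1
  have pv0 : p ⟨3, (0 : Fin 3)⟩ = a ^ 2 * v₀ + 2 * a * b * v₁ + b ^ 2 * v₂ := hv0
  have pv1 : p ⟨3, (1 : Fin 3)⟩ = a * c * v₀ + (a * e + b * c) * v₁ + b * e * v₂ := hv1
  have pv2 : p ⟨3, (2 : Fin 3)⟩ = c ^ 2 * v₀ + 2 * c * e * v₁ + e ^ 2 * v₂ := hv2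
  rw [eq_point p, px0, px1, py0, py1, pu0, pu1, pv0, pv1, pv2]

lemma eval_normalPoint {f : MvPolynomial Coord K} (hf : f ∈ invariantAlgebra K) {p : Coord → K}
    (hp : eval p (generator K 7) ≠ 0) :
    eval (normalPoint fun i => eval p (generator K i)) f = eval p f := by
  obtain ⟨x₀, x₁, y₀, y₁, u₀, u₁, v₀, v₁, v₂, rfl⟩ : ∃ x₀ x₁ y₀ y₁ u₀ u₁ v₀ v₁ v₂,
      p = point x₀ x₁ y₀ y₁ u₀ u₁ v₀ v₁ v₂ := ⟨_, _, _, _, _, _, _, _, _, eq_point p⟩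
  simp only [eval_generator] at hp ⊢
  simp only [normalPoint, generatorValue, Matrix.cons_val] at hp ⊢
  obtain ⟨d, hd⟩ : ∃ d, -x₀ * y₁ + x₁ * y₀ = d := ⟨_, rfl⟩
  rw [hd] at hp ⊢
  -- The matrix with rows `(x₁, -x₀)` and `(-y₁, y₀) / d` has determinant 1 and sends `x` to `(0,
  -- 1)` and `y` to `(d, 0)`, where `d = L₈`.
  have h : x₁ * (y₀ / d) - -x₀ * (-y₁ / d) = 1 := by
    field_simp
    linear_combination hd
  rw [← eval_eq_of_mem_invariantAlgebra hf h x₀ x₁ y₀ y₁ u₀ u₁ v₀ v₁ v₂]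
  congr 2
  congr 1 <;> field_simp <;> first | ring1 | linear_combination hd | linear_combination -hd

theorem mem_range_aeval_generator {f : MvPolynomial Coord K} (hf : f ∈ invariantAlgebra K) :
    f ∈ (aeval (generator K) : PolyRing K →ₐ[K] MvPolynomial Coord K).range := by
  obtain ⟨N, G, hG⟩ := exists_eval_normalPoint f
  have h : generator K 7 ^ N * f = aeval (generator K) G := by
    -- An extra factor `L₈` makes the identity trivial at the points where the normal form is
    -- unavailable.
    refine mul_left_cancel₀ generator_seven_ne_zero (MvPolynomial.funext fun p => ?_)
    rcases eq_or_ne (eval p (generator K 7)) 0 with h7 | h7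
    · simp only [map_mul, h7, zero_mul]
    · simp only [map_mul, map_pow]
      rw [eval_aeval_generator, ← hG _ h7, eval_normalPoint hf h7]
  clear hG
  induction N generalizing G with
  | zero => exact ⟨G, by rw [← one_mul f, ← pow_zero (generator K 7), h]; rfl⟩
  | succ N ih =>
    rw [pow_succ', mul_assoc] at h
    obtain ⟨F', -, hF'⟩ := exists_of_generator_mul_eq h
    exact ih F' hF'.symm

theorem adjoin_generator :
    Algebra.adjoin K (Set.range (generator K)) = invariantAlgebra K := by
  rw [Algebra.adjoin_range_eq_range_aeval]
  refine le_antisymm ?_ fun f hf => mem_range_aeval_generator hf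
  rintro _ ⟨F, rfl⟩
  change aeval (generator K) F ∈ _
  rw [← presentation_coe]
  exact (presentation K F).2

lemma presentation_surjective : Function.Surjective (presentation K) := by
  rintro ⟨f, hf⟩
  obtain ⟨F, hF⟩ := mem_range_aeval_generator hf
  exact ⟨F, Subtype.ext ((presentation_coe F).trans hF)⟩

/-- For each generator there are two points at which only this generator takes different values. -/
lemma exists_points (i : Fin 10) : ∃ p q : Coord → K,
    eval p (generator K i) ≠ eval q (generator K i) ∧
      ∀ j ≠ i, eval p (generator K j) = eval q (generator K j) := by
  have key : ∀ x₀ x₁ y₀ y₁ u₀ u₁ v₀ v₁ v₂ x₀' x₁' y₀' y₁' u₀' u₁' v₀' v₁' v₂' : K,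
      (generatorValue K x₀ x₁ y₀ y₁ u₀ u₁ v₀ v₁ v₂ i ≠
        generatorValue K x₀' x₁' y₀' y₁' u₀' u₁' v₀' v₁' v₂' i ∧
      ∀ j ≠ i, generatorValue K x₀ x₁ y₀ y₁ u₀ u₁ v₀ v₁ v₂ j =
        generatorValue K x₀' x₁' y₀' y₁' u₀' u₁' v₀' v₁' v₂' j) → ∃ p q : Coord → K,
      eval p (generator K i) ≠ eval q (generator K i) ∧
        ∀ j ≠ i, eval p (generator K j) = eval q (generator K j) := by
    intro x₀ x₁ y₀ y₁ u₀ u₁ v₀ v₁ v₂ x₀' x₁' y₀' y₁' u₀' u₁' v₀' v₁' v₂' h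
    refine ⟨point x₀ x₁ y₀ y₁ u₀ u₁ v₀ v₁ v₂,
      point x₀' x₁' y₀' y₁' u₀' u₁' v₀' v₁' v₂', ?_⟩
    simpa only [eval_generator] using h
  have hone : (1 : K) ≠ -1 := fun h => by
    have : (2 : K) = 0 := by linear_combination h
    exact two_ne_zero this
  fin_cases i
  -- For an off-diagonal Gram entry one of two parallel vectors changes sign, which keeps the
  -- diagonal entries. For the other generators the second point has a vector, or everything, set to
  -- zero.
  · refine key 1 0 0 0 1 0 0 0 1 1 0 0 0 (-1) 0 0 0 1 ⟨?_, fun j hj => ?_⟩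
    · simpa [generatorValue] using hone
    · fin_cases j <;> simp [generatorValue] at hj ⊢
  · refine key 0 0 0 0 1 0 0 0 1 0 0 0 0 0 0 0 0 1 ⟨?_, fun j hj => ?_⟩
    · simp [generatorValue]
    · fin_cases j <;> simp [generatorValue] at hj ⊢
  · refine key 0 0 0 0 0 0 1 0 1 0 0 0 0 0 0 0 0 0 ⟨?_, fun j hj => ?_⟩
    · simp [generatorValue]
    · fin_cases j <;> simp [generatorValue] at hj ⊢
  · refine key 1 0 0 0 0 0 0 0 1 0 0 0 0 0 0 0 0 1 ⟨?_, fun j hj => ?_⟩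
    · simp [generatorValue]
    · fin_cases j <;> simp [generatorValue] at hj ⊢
  · refine key 1 0 0 0 0 1 0 0 0 0 0 0 0 0 0 0 0 0 ⟨?_, fun j hj => ?_⟩
    · simp [generatorValue]
    · fin_cases j <;> simp [generatorValue] at hj ⊢
  · refine key 0 0 1 0 1 0 0 0 1 0 0 1 0 (-1) 0 0 0 1 ⟨?_, fun j hj => ?_⟩
    · simpa [generatorValue] using hone
    · fin_cases j <;> simp [generatorValue] at hj ⊢
  · refine key 0 0 1 0 0 0 0 0 1 0 0 0 0 0 0 0 0 1 ⟨?_, fun j hj => ?_⟩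
    · simp [generatorValue]
    · fin_cases j <;> simp [generatorValue] at hj ⊢
  · refine key 1 0 0 1 0 0 0 0 0 0 0 0 0 0 0 0 0 0 ⟨?_, fun j hj => ?_⟩
    · simp [generatorValue]
    · fin_cases j <;> simp [generatorValue] at hj ⊢
  · refine key 0 0 1 0 0 1 0 0 0 0 0 0 0 0 0 0 0 0 ⟨?_, fun j hj => ?_⟩
    · simp [generatorValue]
    · fin_cases j <;> simp [generatorValue] at hj ⊢
  · refine key 1 0 1 0 0 0 0 0 1 1 0 (-1) 0 0 0 0 0 1 ⟨?_, fun j hj => ?_⟩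
    · simpa [generatorValue] using hone
    · fin_cases j <;> simp [generatorValue] at hj ⊢

/-- Polynomials taking equal values at two points form a subalgebra; for suitable points it contains
the other nine generators but not the `i`-th. -/
theorem adjoin_generator_image_compl_ne (i : Fin 10) :
    Algebra.adjoin K (generator K '' {i}ᶜ) ≠ invariantAlgebra K := by
  intro h
  obtain ⟨p, q, hne, heq⟩ := exists_points (K := K) i
  have hi : generator K i ∈ Algebra.adjoin K (generator K '' {i}ᶜ) := h ▸ generator_mem K i
  have hle : Algebra.adjoin K (generator K '' {i}ᶜ) ≤ AlgHom.equalizer (aeval p) (aeval q) := by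
    refine Algebra.adjoin_le ?_
    rintro _ ⟨j, hj, rfl⟩
    simpa [AlgHom.mem_equalizer, aeval_eq_eval] using heq j hj
  exact hne (by simpa [AlgHom.mem_equalizer, aeval_eq_eval] using hle hi)

end Generation

/-! ### Degrees of the generators -/

section Degree

variable {K : Type u} [Field K]

lemma generator_isHomogeneous (i : Fin 10) : (generator K i).IsHomogeneous (weight i) := by
  have h1 : ∀ c, (X c : MvPolynomial Coord K).IsHomogeneous 1 := isHomogeneous_X K
  have h2 : ∀ c c', (X c * X c' : MvPolynomial Coord K).IsHomogeneous 2 :=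
    fun c c' => (h1 c).mul (h1 c')
  have h3 : ∀ c c' c'', (X c * X c' * X c'' : MvPolynomial Coord K).IsHomogeneous 3 :=
    fun c c' c'' => (h2 c c').mul (h1 c'')
  have hs : ∀ c, (X c ^ 2 : MvPolynomial Coord K).IsHomogeneous 2 := fun c => (h1 c).pow 2
  have hs3 : ∀ c c', (X c ^ 2 * X c' : MvPolynomial Coord K).IsHomogeneous 3 :=
    fun c c' => (hs c).mul (h1 c')
  have htwo : (2 : MvPolynomial Coord K).IsHomogeneous 0 := isHomogeneous_C Coord (2 : K)
  have n2 : ∀ c c', (-X c * X c' : MvPolynomial Coord K).IsHomogeneous 2 :=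
    fun c c' => (h1 c).neg.mul (h1 c')
  have n3 : ∀ c c' c'', (-X c * X c' * X c'' : MvPolynomial Coord K).IsHomogeneous 3 :=
    fun c c' c'' => (n2 c c').mul (h1 c'')
  have ns3 : ∀ c c', (-X c ^ 2 * X c' : MvPolynomial Coord K).IsHomogeneous 3 :=
    fun c c' => (hs c).neg.mul (h1 c')
  have t3 : ∀ c c' c'', (2 * X c * X c' * X c'' : MvPolynomial Coord K).IsHomogeneous 3 :=
    fun c c' c'' => ((htwo.mul (h1 c)).mul (h1 c')).mul (h1 c'')
  have t2 : ∀ c c', (2 * X c * X c' : MvPolynomial Coord K).IsHomogeneous 2 :=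
    fun c c' => (htwo.mul (h1 c)).mul (h1 c')
  have nt3 : ∀ c c' c'', (-2 * X c * X c' * X c'' : MvPolynomial Coord K).IsHomogeneous 3 :=
    fun c c' c'' => ((htwo.neg.mul (h1 c)).mul (h1 c')).mul (h1 c'')
  have nts : ∀ c, (-2 * X c ^ 2 : MvPolynomial Coord K).IsHomogeneous 2 :=
    fun c => htwo.neg.mul (hs c)
  fin_cases i
  · exact (((n3 _ _ _).add (h3 _ _ _)).sub (h3 _ _ _)).add (h3 _ _ _)
  · exact ((nt3 _ _ _).add (hs3 _ _)).add (hs3 _ _)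
  · exact (nts _).add (t2 _ _)
  · exact ((ns3 _ _).sub (hs3 _ _)).add (t3 _ _ _)
  · exact (n2 _ _).add (h2 _ _)
  · exact (((h3 _ _ _).sub (h3 _ _ _)).sub (h3 _ _ _)).add (h3 _ _ _)
  · exact ((hs3 _ _).sub (t3 _ _ _)).add (hs3 _ _)
  · exact (n2 _ _).add (h2 _ _)
  · exact (n2 _ _).add (h2 _ _)
  · exact (((h3 _ _ _).sub (h3 _ _ _)).sub (h3 _ _ _)).add (h3 _ _ _)

lemma aeval_generator_isHomogeneous {F : PolyRing K} {n : ℕ}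
    (hF : IsWeightedHomogeneous weight F n) : (aeval (generator K) F).IsHomogeneous n := by
  rw [aeval_def, eval₂_eq]
  refine IsHomogeneous.sum _ _ _ fun m hm => ?_
  rw [algebraMap_eq]
  refine IsHomogeneous.C_mul ?_ _
  have hn : ∑ i, weight i * m i = n := by
    rw [← hF (mem_support_iff.1 hm), Finsupp.weight_apply, Finsupp.sum_fintype _ _ (by simp)]
    simp [mul_comm]
  have : ∏ i ∈ m.support, generator K i ^ m i = ∏ i, generator K i ^ m i :=
    Finset.prod_subset (Finset.subset_univ _) fun i _ hi => by simp [Finsupp.notMem_support_iff.1 hi]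
  rw [this, ← hn]
  exact IsHomogeneous.prod _ _ _ fun i _ => (generator_isHomogeneous i).pow _

end Degree

/-! ### The resolution -/

section Resolution

variable (K : Type u) [Field K]

/-- The differentials of the resolution. -/
def differential : ∀ i, FreeModule K (Fin 10) (twists (i + 1)) →ₗ[PolyRing K]
    FreeModule K (Fin 10) (twists i)
  | 0 => (relationMatrix (halved K)).mulVecLin
  | 1 => (syzygyMatrix (halved K)).mulVecLin
  | 2 => (dualSyzygyMatrix (halved K)).mulVecLin
  | 3 => (dualRelationMatrix (halved K)).mulVecLin
  | _ + 4 => 0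

/-- Duality identifies `F₃` with the dual of `F₁`, twisted by the last degree 17; this gives the
degrees of the dual matrices without a separate check of their entries. -/
lemma twists_get_add_three (i : Fin 9) :
    (twists 3).get i + (twists 1).get (i + 3 : Fin 9) = 17 := by
  revert i
  decide

lemma twists_get_add_eight (i : Fin 16) :
    (twists 2).get i + (twists 2).get (i + 8 : Fin 16) = 17 := by
  revert i
  decide

lemma twists_get_lt : ∀ k < 4, ∀ (i : Fin (twists k).length) (j : Fin (twists (k + 1)).length),
    (twists k).get i < (twists (k + 1)).get j := by
  decide

lemma relationMatrix_degree (i : Fin 1) (j : Fin 9) : (twists 0).get i < (twists 1).get j ∧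
    IsWeightedHomogeneous weight (relationMatrix (halved K) i j)
      ((twists 1).get j - (twists 0).get i) := by
  refine ⟨twists_get_lt 0 (by norm_num) i j, ?_⟩
  obtain rfl : i = 0 := Subsingleton.elim _ _
  exact isWeightedHomogeneous_minimalRelation isWeightedHomogeneous_halved j

lemma syzygyMatrix_degree (i : Fin 9) (j : Fin 16) : (twists 1).get i < (twists 2).get j ∧
    IsWeightedHomogeneous weight (syzygyMatrix (halved K) i j)
      ((twists 2).get j - (twists 1).get i) :=
  ⟨twists_get_lt 1 (by norm_num) i j,
    isWeightedHomogeneous_syzygyMatrix isWeightedHomogeneous_halved i j⟩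

lemma dualSyzygyMatrix_degree (i : Fin 16) (j : Fin 9) : (twists 2).get i < (twists 3).get j ∧
    IsWeightedHomogeneous weight (dualSyzygyMatrix (halved K) i j)
      ((twists 3).get j - (twists 2).get i) := by
  refine ⟨twists_get_lt 2 (by norm_num) i j, ?_⟩
  have h := isWeightedHomogeneous_syzygyMatrix (isWeightedHomogeneous_halved (K := K))
    (j + 3) (i + 8)
  have h1 := twists_get_add_three j
  have h2 := twists_get_add_eight i
  rwa [show (twists 3).get j - (twists 2).get i =
    (twists 2).get (i + 8 : Fin 16) - (twists 1).get (j + 3 : Fin 9) by omega]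

lemma dualRelationMatrix_degree (i : Fin 9) (j : Fin 1) : (twists 3).get i < (twists 4).get j ∧
    IsWeightedHomogeneous weight (dualRelationMatrix (halved K) i j)
      ((twists 4).get j - (twists 3).get i) := by
  refine ⟨twists_get_lt 3 (by norm_num) i j, ?_⟩
  have h := isWeightedHomogeneous_minimalRelation (isWeightedHomogeneous_halved (K := K)) (i + 3)
  have h1 := twists_get_add_three i
  obtain rfl : j = 0 := Subsingleton.elim _ _
  have h4 : (twists 4).get (0 : Fin 1) = 17 := rfl
  rwa [show (twists 4).get (0 : Fin 1) - (twists 3).get i = (twists 1).get (i + 3 : Fin 9) by omega]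

variable [CharZero K]

lemma augmentation_surjective : Function.Surjective (augmentation K) := fun f => by
  obtain ⟨F, hF⟩ := presentation_surjective f
  exact ⟨fun _ => F, hF⟩

lemma exact_augmentation : Function.Exact (differential K 0) (augmentation K) := by
  intro v
  have hker : augmentation K v = 0 ↔ v (0 : Fin 1) ∈ relationIdeal K := by
    rw [← ker_presentation]
    rfl
  rw [hker, relationIdeal, Ideal.mem_span_range_iff_exists_fun]
  constructor
  · rintro ⟨c, hc⟩
    refine ⟨c, ?_⟩
    funext i
    have hi : i = (0 : Fin 1) := Subsingleton.elim (α := Fin 1) _ _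
    rw [hi, ← hc]
    change minimalRelation (halved K) ⬝ᵥ c = _
    exact Finset.sum_congr rfl fun _ _ => mul_comm _ _
  · rintro ⟨c, rfl⟩
    refine ⟨c, ?_⟩
    change _ = minimalRelation (halved K) ⬝ᵥ c
    exact Finset.sum_congr rfl fun _ _ => mul_comm _ _

theorem isMinimalGradedFreeResolution :
    IsMinimalGradedFreeResolution weight (invariantPiece K) twists (differential K)
      (augmentation K) where
  surjective := augmentation_surjective K
  exact_zero := exact_augmentation K
  exact_succ
    | 0 => exact_syzygyMatrix
    | 1 => exact_dualSyzygyMatrix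
    | 2 => exact_dualRelationMatrix
    | 3 => (LinearMap.exact_zero_iff_injective _ _).2 dualRelationMatrix_injective
    | i + 4 => fun v => ⟨fun _ => ⟨0, funext fun j => Fin.elim0 j⟩, fun _ => rfl⟩
  graded_augmentation n v hv := by
    have h := hv (0 : Fin 1) (Set.mem_univ _)
    have h' : v (0 : Fin 1) ∈ twistPiece (K := K) weight 0 n := h
    rw [twistPiece, if_pos (Nat.zero_le n), mem_weightedHomogeneousSubmodule] at h'
    change (presentation K (v (0 : Fin 1)) : MvPolynomial Coord K).IsHomogeneous n
    rw [presentation_coe]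
    exact aeval_generator_isHomogeneous h'
  graded
    | 0 => fun _ _ hv => mulVec_mem_freePiece (s := twists 0) (t := twists 1)
        (A := relationMatrix (halved K)) (relationMatrix_degree K) hv
    | 1 => fun _ _ hv => mulVec_mem_freePiece (s := twists 1) (t := twists 2)
        (A := syzygyMatrix (halved K)) (syzygyMatrix_degree K) hv
    | 2 => fun _ _ hv => mulVec_mem_freePiece (s := twists 2) (t := twists 3)
        (A := dualSyzygyMatrix (halved K)) (dualSyzygyMatrix_degree K) hv
    | 3 => fun _ _ hv => mulVec_mem_freePiece (s := twists 3) (t := twists 4)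
        (A := dualRelationMatrix (halved K)) (dualRelationMatrix_degree K) hv
    | _ + 4 => fun _ _ _ => zero_mem _
  minimal
    | 0 => by
      rintro _ ⟨v, rfl⟩
      exact mulVec_mem_irrelevantIdeal_smul (s := twists 0) (t := twists 1)
        (A := relationMatrix (halved K)) (relationMatrix_degree K) v
    | 1 => by
      rintro _ ⟨v, rfl⟩
      exact mulVec_mem_irrelevantIdeal_smul (s := twists 1) (t := twists 2)
        (A := syzygyMatrix (halved K)) (syzygyMatrix_degree K) v
    | 2 => by
      rintro _ ⟨v, rfl⟩
      exact mulVec_mem_irrelevantIdeal_smul (s := twists 2) (t := twists 3)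
        (A := dualSyzygyMatrix (halved K)) (dualSyzygyMatrix_degree K) v
    | 3 => by
      rintro _ ⟨v, rfl⟩
      exact mulVec_mem_irrelevantIdeal_smul (s := twists 3) (t := twists 4)
        (A := dualRelationMatrix (halved K)) (dualRelationMatrix_degree K) v
    | _ + 4 => by
      rintro _ ⟨v, rfl⟩
      exact zero_mem _

end Resolution

/-! ### The projective dimension -/

section ProjectiveDimension

open CategoryTheory

variable {R : Type u} [CommRing R] {M N P : Type u} [AddCommGroup M] [Module R M]
  [AddCommGroup N] [Module R N] [AddCommGroup P] [Module R P]

lemma hasProjectiveDimensionLT_iff_ker [Module.Projective R M] {f : M →ₗ[R] N}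
    (hf : Function.Surjective f) (n : ℕ) :
    HasProjectiveDimensionLT (ModuleCat.of R N) (n + 2) ↔
      HasProjectiveDimensionLT (ModuleCat.of R (LinearMap.ker f)) (n + 1) :=
  (LinearMap.shortExact_shortComplexKer hf).hasProjectiveDimensionLT_X₃_iff n
    (ModuleCat.projective_of_categoryTheory_projective (ModuleCat.of R M))

lemma hasProjectiveDimensionLT_range_iff [Module.Projective R M] {f : P →ₗ[R] M} {g : M →ₗ[R] N}
    (h : Function.Exact f g) (n : ℕ) :
    HasProjectiveDimensionLT (ModuleCat.of R (LinearMap.range g)) (n + 2) ↔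
      HasProjectiveDimensionLT (ModuleCat.of R (LinearMap.range f)) (n + 1) := by
  rw [hasProjectiveDimensionLT_iff_ker g.surjective_rangeRestrict, LinearMap.ker_rangeRestrict,
    h.linearMap_ker_eq]

lemma hasProjectiveDimensionLT_one_iff :
    HasProjectiveDimensionLT (ModuleCat.of R M) 1 ↔ Module.Projective R M := by
  rw [← projective_iff_hasProjectiveDimensionLT_one, ← IsProjective.iff_projective]

/-- If the range of `g` were projective, `f` would have a retraction `r`, and `P = r (f P) ⊆ r (I M)
⊆ I P`. -/
lemma not_projective_range_of_range_le_smul {f : P →ₗ[R] M} {g : M →ₗ[R] N}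
    (h : Function.Exact f g) (hf : Function.Injective f) {I : Ideal R}
    (hI : LinearMap.range f ≤ I • ⊤) (hP : I • (⊤ : Submodule R P) ≠ ⊤) :
    ¬ Module.Projective R (LinearMap.range g) := by
  intro hproj
  obtain ⟨s, hs⟩ := Module.projective_lifting_property g.rangeRestrict LinearMap.id
    g.surjective_rangeRestrict
  have hexact : Function.Exact f g.rangeRestrict := by
    rw [LinearMap.exact_iff, LinearMap.ker_rangeRestrict, h.linearMap_ker_eq]
  obtain ⟨-, r, hr⟩ := (hexact.split_tfae'.out 0 1 :
    (Function.Injective f ∧ ∃ l, g.rangeRestrict ∘ₗ l = LinearMap.id) ↔ _).1 ⟨hf, s, hs⟩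
  refine hP (top_le_iff.1 fun p _ => ?_)
  have hp : r (f p) ∈ (I • (⊤ : Submodule R M)).map r := ⟨_, hI ⟨p, rfl⟩, rfl⟩
  rw [Submodule.map_smul''] at hp
  rw [← LinearMap.comp_apply, hr] at hp
  exact Submodule.smul_mono le_rfl le_top hp

lemma smul_top_pi_ne_top {I : Ideal R} (hI : I ≠ ⊤) {ι : Type*} (i : ι) :
    I • (⊤ : Submodule R (ι → R)) ≠ ⊤ := by
  intro h
  have hmem : (1 : ι → R) ∈ I • (⊤ : Submodule R (ι → R)) := by
    rw [h]
    trivial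
  have key : ∀ v ∈ I • (⊤ : Submodule R (ι → R)), v i ∈ I := fun v hv =>
    Submodule.smul_induction_on hv (fun r hr _ _ => I.mul_mem_right _ hr)
      fun _ _ hx hy => I.add_mem hx hy
  exact hI ((Ideal.eq_top_iff_one I).2 (key 1 hmem))

variable (K : Type u) [Field K]

lemma irrelevantIdeal_ne_top : irrelevantIdeal K (Fin 10) ≠ ⊤ := by
  have h : irrelevantIdeal K (Fin 10) ≤ RingHom.ker (constantCoeff (R := K)) :=
    Ideal.span_le.2 (by rintro _ ⟨i, rfl⟩; simp)
  exact fun h1 => RingHom.ker_ne_top _ (top_le_iff.1 (h1 ▸ h))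

variable [CharZero K]

lemma hasProjectiveDimensionLT_iff_range_zero (n : ℕ) :
    HasProjectiveDimensionLT (ModuleCat.of (PolyRing K) (invariantAlgebra K)) (n + 2) ↔
      HasProjectiveDimensionLT
        (ModuleCat.of (PolyRing K) (LinearMap.range (differential K 0))) (n + 1) := by
  rw [hasProjectiveDimensionLT_iff_ker (augmentation_surjective K),
    (exact_augmentation K).linearMap_ker_eq]

theorem projectiveDimension_invariantAlgebra :
    projectiveDimension (ModuleCat.of (PolyRing K) (invariantAlgebra K)) = 4 := by
  have hres := isMinimalGradedFreeResolution K
  have hinj : Function.Injective (differential K 3) := dualRelationMatrix_injective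
  apply le_antisymm
  · rw [show (4 : WithBot ℕ∞) = ((4 : ℕ) : WithBot ℕ∞) from rfl, projectiveDimension_le_iff]
    -- Four dimension shifts lead to the range of the last differential, which is free because that
    -- map is injective.
    change HasProjectiveDimensionLT _ (3 + 2)
    rw [hasProjectiveDimensionLT_iff_range_zero,
      hasProjectiveDimensionLT_range_iff (hres.exact_succ 0),
      hasProjectiveDimensionLT_range_iff (hres.exact_succ 1),
      hasProjectiveDimensionLT_range_iff (hres.exact_succ 2)]
    exact hasProjectiveDimensionLT_one_iff.2
      (Module.Projective.of_equiv (LinearEquiv.ofInjective _ hinj))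
  · rw [show (4 : WithBot ℕ∞) = ((4 : ℕ) : WithBot ℕ∞) from rfl, projectiveDimension_ge_iff]
    -- Three shifts lead to the range of `differential K 2`, whose projectivity would split the last
    -- differential against minimality.
    change ¬ HasProjectiveDimensionLT _ (2 + 2)
    rw [hasProjectiveDimensionLT_iff_range_zero,
      hasProjectiveDimensionLT_range_iff (hres.exact_succ 0),
      hasProjectiveDimensionLT_range_iff (hres.exact_succ 1)]
    exact fun h => not_projective_range_of_range_le_smul (hres.exact_succ 2) hinj
      (hres.minimal 3) 
      (smul_top_pi_ne_top (irrelevantIdeal_ne_top K) (0 : Fin 1)) (hasProjectiveDimensionLT_one_iff.1 h)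

end ProjectiveDimension

end SL2Inv

end

theorem mainTheorem2 (K : Type*) [Field K] [CharZero K] :
    -- the listed polynomials are homogeneous of the stated degrees and generate the invariants
    (∀ i, (SL2Inv.generator K i).IsHomogeneous (SL2Inv.weight i)) ∧
    Algebra.adjoin K (Set.range (SL2Inv.generator K)) = SL2Inv.invariantAlgebra K ∧
    -- no one of them can be omitted
    (∀ i, Algebra.adjoin K (SL2Inv.generator K '' {i}ᶜ) ≠ SL2Inv.invariantAlgebra K) ∧
    -- the ideal of relations
    RingHom.ker (SL2Inv.presentation K) = Ideal.span (Set.range (SL2Inv.relation K)) ∧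
    -- the minimal graded free resolution
    (∃ δ : ∀ i, SL2Inv.FreeModule K (Fin 10) (SL2Inv.twists (i + 1)) →ₗ[SL2Inv.PolyRing K]
        SL2Inv.FreeModule K (Fin 10) (SL2Inv.twists i),
      SL2Inv.IsMinimalGradedFreeResolution SL2Inv.weight (SL2Inv.invariantPiece K)
        SL2Inv.twists δ (SL2Inv.augmentation K)) ∧
    -- the homological dimension
    CategoryTheory.projectiveDimension
      (ModuleCat.of (SL2Inv.PolyRing K) (SL2Inv.invariantAlgebra K)) = 4 := by
  refine ⟨SL2Inv.generator_isHomogeneous, SL2Inv.adjoin_generator,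
    SL2Inv.adjoin_generator_image_compl_ne, ?_,
    ⟨SL2Inv.differential K, SL2Inv.isMinimalGradedFreeResolution K⟩,
    SL2Inv.projectiveDimension_invariantAlgebra K⟩
  rw [SL2Inv.ker_presentation, SL2Inv.span_relation, SL2Inv.relationIdeal]
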